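/- Let $p,q\ge 1$ be integers and let $(\overline M,\overline g,J)$ be a locally metallic Riemannian manifold of dimension $n+r$: $\overline g$ is a smooth Riemannian metric and $J$ is a smooth $(1,1)$-tensor field on $\overline M$ with $J^2=pJ+qI$, $\overline g(JX,Y)=\overline g(X,JY)$ and $\overline\nabla J=0$, where $\overline\nabla$ is the Levi-Civita connection of $\overline g$. Let $i:M\to\overline M$ be a smooth isometric immersion of an $n$-dimensional Riemannian manifold $(M,g)$ (a submanifold of codimension $r$), and let $N_1,\dots,N_r$ be a smooth orthonormal frame of the normal bundle over an open set $U\subseteq M$. On $U$ define a $(1,1)$-tensor field $P$, $1$-forms $u_\alpha$, vector fields $\xi_\alpha$ and functions $a_{\alpha\beta}$ by $$J(i_*X)=i_*(PX)+\sum_{\alpha=1}^r u_\alpha(X)N_\alpha,\qquad J N_\alpha=i_*\xi_\alpha+\sum_{\beta=1}^r a_{\alpha\beta}N_\beta,$$ and define the Weingarten operators $A_\alpha$ and the coefficients $l_{\alpha\beta}$ of the normal connection by $$\overline\nabla_X N_\alpha=-i_*(A_\alpha X)+\sum_{\beta=1}^r l_{\alpha\beta}(X)N_\beta .$$ Put $B_\alpha=PA_\alpha-A_\alpha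 P$, $N_P(X,Y)=[PX,PY]+P^2[X,Y]-P[PX,Y]-P[X,PY]$, and let $du_\alpha$ be normalised by $2\,du_\alpha(X,Y)=X(u_\alpha(Y))-Y(u_\alpha(X))-u_\alpha([X,Y])$. Then for all smooth vector fields $X,Y$, at every point of $U$, $$N_P(X,Y)-2\sum_{\alpha=1}^r du_\alpha(X,Y)\,\xi_\alpha=\sum_{\alpha=1}^r\bigl[g(X,\xi_\alpha)B_\alpha Y-g(Y,\xi_\alpha)B_\alpha X\bigr]-\sum_{\alpha=1}^r\sum_{\beta=1}^r\bigl[l_{\alpha\beta}(X)g(Y,\xi_\beta)-l_{\alpha\beta}(Y)g(X,\xi_\beta)\bigr]\xi_\alpha .$$ -/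

import Mathlib

open Bundle Manifold
open scoped Manifold ContDiff Topology

noncomputable section

namespace SigmaMetallic

section Ambient

variable {E : Type*} [NormedAddCommGroup E] [NormedSpace ℝ E] [FiniteDimensional ℝ E]
  {H : Type*} [TopologicalSpace H] {I : ModelWithCorners ℝ E H}
  {M : Type*} [TopologicalSpace M] [ChartedSpace H M] [IsManifold I ∞ M]

/-- A smooth `(1,1)`-tensor field: a smooth section of the bundle of endomorphisms of `TM`. -/
def IsSmoothEndomorphismField (I : ModelWithCorners ℝ E H)
    [IsManifold I ∞ M]
    (J : Π x : M, TangentSpace I x →L[ℝ] TangentSpace I x) : Prop :=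
  ContMDiff I (I.prod 𝓘(ℝ, E →L[ℝ] E)) ∞
    (fun x : M ↦ TotalSpace.mk' (E →L[ℝ] E)
      (E := fun x : M ↦ TangentSpace I x →L[ℝ] TangentSpace I x) x (J x))

/-- The Nijenhuis torsion
`N_P(X, Y) = [PX, PY] + P² [X, Y] - P [PX, Y] - P [X, PY]` of a `(1,1)`-tensor field `P`. -/
def nijenhuis (P : Π x : M, TangentSpace I x →L[ℝ] TangentSpace I x)
    (X Y : Π x : M, TangentSpace I x) (x : M) : TangentSpace I x :=
  VectorField.mlieBracket I (fun y ↦ P y (X y)) (fun y ↦ P y (Y y)) x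
    + P x (P x (VectorField.mlieBracket I X Y x))
    - P x (VectorField.mlieBracket I (fun y ↦ P y (X y)) Y x)
    - P x (VectorField.mlieBracket I X (fun y ↦ P y (Y y)) x)

/-- The exterior derivative of a `1`-form `u`, with the normalisation
`2 du(X, Y) = X(u(Y)) - Y(u(X)) - u([X, Y])`. -/
def exteriorDeriv (u : Π x : M, TangentSpace I x →L[ℝ] ℝ)
    (X Y : Π x : M, TangentSpace I x) (x : M) : ℝ :=
  (1 / 2 : ℝ) * (mvfderiv I (fun y ↦ u y (Y y)) x (X x)
    - mvfderiv I (fun y ↦ u y (X y)) x (Y x)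
    - u x (VectorField.mlieBracket I X Y x))

variable [RiemannianBundle (fun x : M ↦ TangentSpace I x)]
  [IsContMDiffRiemannianBundle I ∞ E (fun x : M ↦ TangentSpace I x)]

/-- `D` is the Levi-Civita connection of the Riemannian manifold `M`: the (unique) connection on
`TM` that is compatible with the metric, `v (g(Y, Z)) = g(D_v Y, Z) + g(Y, D_v Z)`, and
torsion-free. -/
structure IsLeviCivita
    (D : CovariantDerivative I E (fun x : M ↦ TangentSpace I x)) : Prop where
  metric : ∀ (x : M) (v : TangentSpace I x) (Y Z : Π y : M, TangentSpace I y),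
    MDifferentiableAt I I.tangent (fun y ↦ (⟨y, Y y⟩ : TangentBundle I M)) x →
    MDifferentiableAt I I.tangent (fun y ↦ (⟨y, Z y⟩ : TangentBundle I M)) x →
    mvfderiv I (fun y ↦ (inner ℝ (Y y) (Z y) : ℝ)) x v
      = inner ℝ (D Y x v) (Z x) + inner ℝ (Y x) (D Z x v)
  torsion_free : D.torsion = 0

/-- `(g, J)` is a metallic Riemannian structure with parameters `p, q`, where `g` is the
Riemannian metric of `M`: `J² = p J + q I` and `g(JX, Y) = g(X, JY)`, with `p, q ≥ 1` integers. -/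
structure IsMetallicRiemannian (p q : ℕ)
    (J : Π x : M, TangentSpace I x →L[ℝ] TangentSpace I x) : Prop where
  p_pos : 0 < p
  q_pos : 0 < q
  smooth : IsSmoothEndomorphismField I J
  sq_eq : ∀ (x : M) (v : TangentSpace I x), J x (J x v) = (p : ℝ) • J x v + (q : ℝ) • v
  compatible : ∀ (x : M) (v w : TangentSpace I x), inner ℝ (J x v) w = inner ℝ v (J x w)

/-- `(M, g, J)` is a locally metallic Riemannian manifold: it is metallic Riemannian and `J` is
parallel for the Levi-Civita connection `D`, i.e. `(D_v J) Y = D_v (JY) - J (D_v Y) = 0` for all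
tangent vectors `v` at `x` and all vector fields `Y` that are smooth near `x`. -/
structure IsLocallyMetallic (p q : ℕ)
    (D : CovariantDerivative I E (fun x : M ↦ TangentSpace I x))
    (J : Π x : M, TangentSpace I x →L[ℝ] TangentSpace I x) : Prop
    extends IsMetallicRiemannian p q J where
  leviCivita : IsLeviCivita D
  parallel : ∀ (x : M) (Y : Π y : M, TangentSpace I y),
    ContMDiffAt I I.tangent ∞ (fun y ↦ (⟨y, Y y⟩ : TangentBundle I M)) x →
    ∀ v : TangentSpace I x, D (fun y ↦ J y (Y y)) x v = J x (D Y x v)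

end Ambient

section Submanifold

variable {E : Type*} [NormedAddCommGroup E] [NormedSpace ℝ E] [FiniteDimensional ℝ E]
  {H : Type*} [TopologicalSpace H] {I : ModelWithCorners ℝ E H}
  {M : Type*} [TopologicalSpace M] [ChartedSpace H M] [IsManifold I ∞ M]
  [RiemannianBundle (fun x : M ↦ TangentSpace I x)]
  {E' : Type*} [NormedAddCommGroup E'] [NormedSpace ℝ E'] [FiniteDimensional ℝ E']
  {H' : Type*} [TopologicalSpace H'] {I' : ModelWithCorners ℝ E' H'}
  {M' : Type*} [TopologicalSpace M'] [ChartedSpace H' M'] [IsManifold I' ∞ M']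
  [RiemannianBundle (fun y : M' ↦ TangentSpace I' y)]

/-- `i : M → M'` is a smooth isometric immersion: `g(v, w) = g'(i_* v, i_* w)`. (So `i_*` is
injective at every point.) -/
structure IsIsometricImmersion (I : ModelWithCorners ℝ E H) (I' : ModelWithCorners ℝ E' H')
    [RiemannianBundle (fun x : M ↦ TangentSpace I x)]
    [RiemannianBundle (fun y : M' ↦ TangentSpace I' y)] (i : M → M') : Prop where
  smooth : ContMDiff I I' ∞ i
  isometric : ∀ (x : M) (v w : TangentSpace I x),
    inner ℝ (mfderiv I I' i x v) (mfderiv I I' i x w) = inner ℝ v w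

/-- `N₁, …, N_r` is a smooth orthonormal frame of normal vector fields along `i` over `U ⊆ M`.
(When `r` is the codimension it is a basis of the normal space at each point of `U`.) -/
structure IsOrthonormalNormalFrame (I : ModelWithCorners ℝ E H) (I' : ModelWithCorners ℝ E' H')
    [IsManifold I' ∞ M'] [RiemannianBundle (fun y : M' ↦ TangentSpace I' y)]
    (i : M → M') (U : Set M) {r : ℕ}
    (N : Fin r → Π x : M, TangentSpace I' (i x)) : Prop where
  smooth : ∀ α, ContMDiffOn I I'.tangent ∞
    (fun x ↦ (⟨i x, N α x⟩ : TangentBundle I' M')) U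
  orthonormal : ∀ x ∈ U, Orthonormal ℝ (fun α ↦ N α x)
  normal : ∀ x ∈ U, ∀ α (v : TangentSpace I x), inner ℝ (mfderiv I I' i x v) (N α x) = 0

/-- The derivative `D_v V` of a vector field `V` along a map `i : M → M'` (the pull-back of the
connection `D` on `TM'`), as a linear map in the tangent vector `v` of `M` at `x`. If `e_k` is the
frame of `TM'` near `i x` given by a local trivialisation and `V = ∑ V^k e_k ∘ i`, then
`D_v V = ∑ dV^k(v) e_k + V^k(x) D_{i_* v} e_k`; the section `∑ V^k(x) e_k` with constant
coefficients is `FiberBundle.extend E' (V x)`. -/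
def covDerivAlong (I : ModelWithCorners ℝ E H) {I' : ModelWithCorners ℝ E' H'}
    [IsManifold I' ∞ M']
    (D : CovariantDerivative I' E' (fun y : M' ↦ TangentSpace I' y))
    (i : M → M') (V : Π x : M, TangentSpace I' (i x)) (x : M) :
    TangentSpace I x →L[ℝ] TangentSpace I' (i x) :=
  let e := trivializationAt E' (fun y : M' ↦ TangentSpace I' y) (i x)
  e.symmL ℝ (i x) ∘L mvfderiv I (fun y : M ↦ (e ⟨i y, V y⟩).2) x
    + D (FiberBundle.extend E' (V x)) (i x) ∘L mfderiv I I' i x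

/-- The tangential component `i_*⁻¹ (Z^⊤)`, as a tangent vector of `M` at `x`, of a tangent vector
`Z` of `M'` at `i x`: the vector `w` with `g(w, v) = g'(Z, i_* v)` for all `v`, that is the adjoint
of `i_*` applied to `Z`. -/
def tangentialPart (I : ModelWithCorners ℝ E H) (I' : ModelWithCorners ℝ E' H')
    [RiemannianBundle (fun x : M ↦ TangentSpace I x)]
    [RiemannianBundle (fun y : M' ↦ TangentSpace I' y)] (i : M → M') (x : M) :
    TangentSpace I' (i x) →L[ℝ] TangentSpace I x :=
  haveI : FiniteDimensional ℝ (TangentSpace I x) := inferInstanceAs (FiniteDimensional ℝ E)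
  haveI : FiniteDimensional ℝ (TangentSpace I' (i x)) :=
    inferInstanceAs (FiniteDimensional ℝ E')
  haveI : CompleteSpace (TangentSpace I x) := FiniteDimensional.complete ℝ _
  haveI : CompleteSpace (TangentSpace I' (i x)) := FiniteDimensional.complete ℝ _
  ContinuousLinearMap.adjoint (mfderiv I I' i x)

/-- The `(1,1)`-tensor field `P` of the induced structure: `PX` is the tangential component of
`J (i_* X)`. -/
def inducedP (i : M → M') (J : Π y : M', TangentSpace I' y →L[ℝ] TangentSpace I' y) (x : M) :
    TangentSpace I x →L[ℝ] TangentSpace I x :=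
  tangentialPart I I' i x ∘L J (i x) ∘L mfderiv I I' i x

/-- The `1`-form `u_α` of the induced structure: `u_α(X) = g'(J (i_* X), N_α)` is the coefficient
of `N_α` in the normal component of `J (i_* X)`. Here `ν = N_α`. -/
def inducedForm (I : ModelWithCorners ℝ E H) (i : M → M')
    (J : Π y : M', TangentSpace I' y →L[ℝ] TangentSpace I' y)
    (ν : Π x : M, TangentSpace I' (i x)) (x : M) : TangentSpace I x →L[ℝ] ℝ :=
  innerSL ℝ (ν x) ∘L J (i x) ∘L mfderiv I I' i x

/-- The vector field `ξ_α` of the induced structure: the tangential component of `J N_α`.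
Here `ν = N_α`. -/
def inducedField (I : ModelWithCorners ℝ E H)
    [RiemannianBundle (fun x : M ↦ TangentSpace I x)] (i : M → M')
    (J : Π y : M', TangentSpace I' y →L[ℝ] TangentSpace I' y)
    (ν : Π x : M, TangentSpace I' (i x)) (x : M) : TangentSpace I x :=
  tangentialPart I I' i x (J (i x) (ν x))

/-- The shape (Weingarten) operator `A_α` of the normal field `ν = N_α`: `-A_α X` is the tangential
component of `D_X N_α`. -/
def shapeOperator (I : ModelWithCorners ℝ E H)
    [RiemannianBundle (fun x : M ↦ TangentSpace I x)]
    (D : CovariantDerivative I' E' (fun y : M' ↦ TangentSpace I' y))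
    (i : M → M') (ν : Π x : M, TangentSpace I' (i x)) (x : M) :
    TangentSpace I x →L[ℝ] TangentSpace I x :=
  -(tangentialPart I I' i x ∘L covDerivAlong I D i ν x)

/-- The coefficient `l_{αβ}(X) = g'(D_X N_α, N_β)` of the normal connection: the normal component
of `D_X N_α` is `∑_β l_{αβ}(X) N_β`. Here `ν = N_α` and `η = N_β`. -/
def normalConnectionCoeff (I : ModelWithCorners ℝ E H)
    (D : CovariantDerivative I' E' (fun y : M' ↦ TangentSpace I' y))
    (i : M → M') (ν η : Π x : M, TangentSpace I' (i x)) (x : M) : TangentSpace I x →L[ℝ] ℝ :=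
  innerSL ℝ (η x) ∘L covDerivAlong I D i ν x

/-- `B_α = P A_α - A_α P`. Here `ν = N_α`. -/
def commutatorB (I : ModelWithCorners ℝ E H)
    [RiemannianBundle (fun x : M ↦ TangentSpace I x)]
    (D : CovariantDerivative I' E' (fun y : M' ↦ TangentSpace I' y))
    (i : M → M') (J : Π y : M', TangentSpace I' y →L[ℝ] TangentSpace I' y)
    (ν : Π x : M, TangentSpace I' (i x)) (x : M) :
    TangentSpace I x →L[ℝ] TangentSpace I x :=
  inducedP i J x ∘L shapeOperator I D i ν x - shapeOperator I D i ν x ∘L inducedP i J x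

end Submanifold

end SigmaMetallic

end

open SigmaMetallic

/-! The pull-back of `D` along `i` obeys the Leibniz rule, is compatible with the metric, commutes
with `J`, and satisfies `D_X(i_* Y) - D_Y(i_* X) = i_*[X, Y]`. Write `∇` for the tangential part of
`D_X(i_* Y)`: it is a torsion-free derivative on `M`, so no separate connection on `M` is needed.
Differentiating `i_*(PY) = J(i_* Y) - ∑ u_α(Y) N_α` and taking tangential parts gives `(∇_X P)Y = ∑
(g(A_α X, Y) ξ_α + u_α(Y) A_α X)`.

Since `∇` is torsion-free, `N_P(X, Y) = (∇_{PX} P)Y - (∇_{PY} P)X + P(∇_Y P)X - P(∇_X P)Y`.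
Substitution and the symmetry of `A_α` leave the `B_α` terms together with `∑ (g(A_α Y, PX) - g(A_α
X, PY)) ξ_α`. Differentiating `u_α(Y) = g'(N_α, J i_* Y)` shows that `2 du_α(X, Y)` is this same
coefficient plus the `l_{αβ}` terms, so the subtraction leaves exactly the right-hand side.

The carrying lemmas are `MDiffAlongAt.induction`, `covDerivAlong_mfderiv_sub`,
`tangentialPart_covDerivAlong_inducedP`, `two_mul_exteriorDeriv_inducedForm` and
`nijenhuis_inducedP`. -/

noncomputable section

namespace SigmaMetallic

set_option linter.unusedSectionVars false

/-! ### Differentiable vector fields along a map -/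

section Along

variable {E : Type*} [NormedAddCommGroup E] [NormedSpace ℝ E]
  {H : Type*} [TopologicalSpace H] {I : ModelWithCorners ℝ E H}
  {M : Type*} [TopologicalSpace M] [ChartedSpace H M]
  {E' : Type*} [NormedAddCommGroup E'] [NormedSpace ℝ E']
  {H' : Type*} [TopologicalSpace H'] {I' : ModelWithCorners ℝ E' H'}
  {M' : Type*} [TopologicalSpace M'] [ChartedSpace H' M'] [IsManifold I' ∞ M']

/-- A vector field along `i`, expressed in the trivialization of `TM'` at `i x`. -/
def alongCoord (I' : ModelWithCorners ℝ E' H') [IsManifold I' ∞ M'] {i : M → M'}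
    (V : Π x : M, TangentSpace I' (i x)) (x y : M) : E' :=
  (trivializationAt E' (fun y : M' ↦ TangentSpace I' y) (i x) ⟨i y, V y⟩).2

/-- `V` is a vector field along `i` which is differentiable at `x`. -/
def MDiffAlongAt (I : ModelWithCorners ℝ E H) (I' : ModelWithCorners ℝ E' H')
    [IsManifold I' ∞ M'] {i : M → M'} (V : Π x : M, TangentSpace I' (i x)) (x : M) : Prop :=
  MDifferentiableAt I I'.tangent (fun y ↦ (⟨i y, V y⟩ : TangentBundle I' M')) x

variable {i : M → M'} {V W : Π x : M, TangentSpace I' (i x)} {x : M}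

theorem MDiffAlongAt.base (hV : MDiffAlongAt I I' V x) : MDifferentiableAt I I' i x :=
  ((mdifferentiableAt_totalSpace I' (E := fun y : M' ↦ TangentSpace I' y) _).1 hV).1

theorem mdiffAlongAt_iff : MDiffAlongAt I I' V x ↔
    MDifferentiableAt I I' i x ∧ MDifferentiableAt I 𝓘(ℝ, E') (alongCoord I' V x) x :=
  mdifferentiableAt_totalSpace I' (E := fun y : M' ↦ TangentSpace I' y) _

theorem MDiffAlongAt.coord (hV : MDiffAlongAt I I' V x) :
    MDifferentiableAt I 𝓘(ℝ, E') (alongCoord I' V x) x :=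
  (mdiffAlongAt_iff.1 hV).2

theorem eventually_mem_baseSet (hi : MDifferentiableAt I I' i x) :
    ∀ᶠ y in 𝓝 x, i y ∈ (trivializationAt E' (fun y : M' ↦ TangentSpace I' y) (i x)).baseSet :=
  hi.continuousAt.eventually_mem
    ((trivializationAt E' (fun y : M' ↦ TangentSpace I' y) (i x)).open_baseSet.mem_nhds
      (FiberBundle.mem_baseSet_trivializationAt' (i x)))

theorem alongCoord_eq {y : M}
    (hy : i y ∈ (trivializationAt E' (fun y : M' ↦ TangentSpace I' y) (i x)).baseSet) :
    alongCoord I' V x y =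
      (trivializationAt E' (fun y : M' ↦ TangentSpace I' y) (i x)).continuousLinearMapAt ℝ (i y)
        (V y) := by
  simp [alongCoord, Trivialization.continuousLinearMapAt_apply,
    Trivialization.coe_linearMapAt_of_mem _ hy]

theorem alongCoord_congr (h : ∀ᶠ y in 𝓝 x, V y = W y) :
    alongCoord I' V x =ᶠ[𝓝 x] alongCoord I' W x := by
  filter_upwards [h] with y hy
  simp [alongCoord, hy]

theorem alongCoord_add (hi : MDifferentiableAt I I' i x) :
    alongCoord I' (fun y ↦ V y + W y) x =ᶠ[𝓝 x] alongCoord I' V x + alongCoord I' W x := by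
  filter_upwards [eventually_mem_baseSet hi] with y hy
  simp only [Pi.add_apply, alongCoord_eq hy, map_add]

theorem alongCoord_smul (hi : MDifferentiableAt I I' i x) (f : M → ℝ) :
    alongCoord I' (fun y ↦ f y • V y) x =ᶠ[𝓝 x] f • alongCoord I' V x := by
  filter_upwards [eventually_mem_baseSet hi] with y hy
  simp only [Pi.smul_apply', alongCoord_eq hy, map_smul]

theorem MDiffAlongAt.congr (hV : MDiffAlongAt I I' V x) (h : ∀ᶠ y in 𝓝 x, W y = V y) :
    MDiffAlongAt I I' W x :=
  mdiffAlongAt_iff.2 ⟨hV.base, hV.coord.congr_of_eventuallyEq (alongCoord_congr h)⟩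

theorem MDiffAlongAt.add (hV : MDiffAlongAt I I' V x) (hW : MDiffAlongAt I I' W x) :
    MDiffAlongAt I I' (fun y ↦ V y + W y) x :=
  mdiffAlongAt_iff.2 ⟨hV.base, (hV.coord.add hW.coord).congr_of_eventuallyEq
    (alongCoord_add hV.base)⟩

theorem MDiffAlongAt.smul {f : M → ℝ} (hf : MDifferentiableAt I 𝓘(ℝ, ℝ) f x)
    (hV : MDiffAlongAt I I' V x) : MDiffAlongAt I I' (fun y ↦ f y • V y) x :=
  mdiffAlongAt_iff.2 ⟨hV.base, (hf.smul hV.coord).congr_of_eventuallyEq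
    (alongCoord_smul hV.base f)⟩

theorem MDiffAlongAt.comp {s : Π y : M', TangentSpace I' y}
    (hs : MDifferentiableAt I' I'.tangent (fun y ↦ (⟨y, s y⟩ : TangentBundle I' M')) (i x))
    (hi : MDifferentiableAt I I' i x) : MDiffAlongAt I I' (fun y ↦ s (i y)) x :=
  MDifferentiableAt.comp x hs hi

variable [FiniteDimensional ℝ E']

/-- To prove a property of all vector fields along `i` which are differentiable at `x`, it suffices
to prove that it is local, that it is preserved under sums and under multiplication by functions,
and that it holds for the restrictions of smooth vector fields on `M'`. -/
theorem MDiffAlongAt.induction {p : (Π x : M, TangentSpace I' (i x)) → Prop}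
    (congr : ∀ V W, MDiffAlongAt I I' V x → (∀ᶠ y in 𝓝 x, W y = V y) → p V → p W)
    (add : ∀ V W, MDiffAlongAt I I' V x → MDiffAlongAt I I' W x → p V → p W →
      p (fun y ↦ V y + W y))
    (smul : ∀ (f : M → ℝ) V, MDifferentiableAt I 𝓘(ℝ, ℝ) f x → MDiffAlongAt I I' V x → p V →
      p (fun y ↦ f y • V y))
    (comp : ∀ s : Π y : M', TangentSpace I' y,
      ContMDiffAt I' I'.tangent ∞ (fun y ↦ (⟨y, s y⟩ : TangentBundle I' M')) (i x) →
      p (fun y ↦ s (i y)))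
    (hV : MDiffAlongAt I I' V x) : p V := by
  classical
  have hi := hV.base
  let e := trivializationAt E' (fun y : M' ↦ TangentSpace I' y) (i x)
  let b := Module.finBasis ℝ E'
  -- A local frame of `TM'` is smooth, so the generating case `comp` may assume smoothness although
  -- `V` is only differentiable; the parallelism of `J` is given only for smooth fields.
  let s : Fin (Module.finrank ℝ E') → Π y : M', TangentSpace I' y := e.localFrame b
  have hmem : i x ∈ e.baseSet := FiberBundle.mem_baseSet_trivializationAt' (i x)
  have hs (k) : ContMDiffAt I' I'.tangent ∞ (fun y ↦ (⟨y, s k y⟩ : TangentBundle I' M')) (i x) :=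
    contMDiffAt_localFrame_of_mem ∞ e b k hmem
  let c : Fin (Module.finrank ℝ E') → M → ℝ := fun k y ↦ b.repr (alongCoord I' V x y) k
  have hc (k) : MDifferentiableAt I 𝓘(ℝ, ℝ) (c k) x := by
    have : Differentiable ℝ (fun v : E' ↦ b.repr v k) :=
      (LinearMap.toContinuousLinearMap (b.coord k)).differentiable
    exact (this _).comp_mdifferentiableAt hV.coord
  have key (t : Finset (Fin (Module.finrank ℝ E'))) :
      MDiffAlongAt I I' (i := i) (fun y ↦ ∑ k ∈ t, c k y • s k (i y)) x ∧
        p (fun y ↦ ∑ k ∈ t, c k y • s k (i y)) := by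
    induction t using Finset.induction_on with
    | empty =>
      have h0 : ContMDiffAt I' I'.tangent ∞
          (fun y ↦ (⟨y, (0 : TangentSpace I' y)⟩ : TangentBundle I' M')) (i x) :=
        contMDiff_zeroSection ℝ (fun y : M' ↦ TangentSpace I' y) (i x)
      simp only [Finset.sum_empty]
      exact ⟨.comp (s := fun y ↦ (0 : TangentSpace I' y)) (h0.mdifferentiableAt (by simp)) hi,
        comp (fun y ↦ 0) h0⟩
    | insert k t hk ih =>
      have h1 := MDiffAlongAt.comp ((hs k).mdifferentiableAt (by simp)) hi
      have h2 := h1.smul (hc k)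
      simp only [Finset.sum_insert hk]
      exact ⟨h2.add ih.1, add _ _ h2 ih.1 (smul _ _ (hc k) h1 (comp _ (hs k))) ih.2⟩
  -- The frame expansion of `V` is valid only where `i y` lies in the base set, hence the appeal to
  -- locality.
  refine congr _ V (key Finset.univ).1 ?_ (key Finset.univ).2
  filter_upwards [eventually_mem_baseSet hi] with y hy
  have h3 : V y = e.symmL ℝ (i y) (alongCoord I' V x y) := by
    rw [alongCoord_eq hy]
    exact (e.symmL_continuousLinearMapAt hy _).symm
  conv_lhs => rw [h3, ← b.sum_repr (alongCoord I' V x y), map_sum]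
  refine Finset.sum_congr rfl fun k _ ↦ ?_
  rw [map_smul]
  congr 1
  have hy' : i y ∈ e.baseSet := hy
  simp [s, e.localFrame_apply_of_mem_baseSet b hy', Trivialization.basisAt, e.symmL_apply hy']

end Along

/-! ### The pulled-back connection: Leibniz rule, chain rule, compatibility with the metric and with
`J` -/

section CovDerivAlong

variable {E : Type*} [NormedAddCommGroup E] [NormedSpace ℝ E] [FiniteDimensional ℝ E]
  {H : Type*} [TopologicalSpace H] {I : ModelWithCorners ℝ E H}
  {M : Type*} [TopologicalSpace M] [ChartedSpace H M]
  {E' : Type*} [NormedAddCommGroup E'] [NormedSpace ℝ E'] [FiniteDimensional ℝ E']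
  {H' : Type*} [TopologicalSpace H'] {I' : ModelWithCorners ℝ E' H'}
  {M' : Type*} [TopologicalSpace M'] [ChartedSpace H' M'] [IsManifold I' ∞ M']
  {i : M → M'} {V W : Π x : M, TangentSpace I' (i x)} {x : M}

theorem mvfderiv_congr {F : Type*} [NormedAddCommGroup F] [NormedSpace ℝ F] {f g : M → F}
    (h : f =ᶠ[𝓝 x] g) (v : TangentSpace I x) : mvfderiv I f x v = mvfderiv I g x v := by
  simp only [mvfderiv, ContinuousLinearMap.comp_apply]
  rw [h.mfderiv_eq, h.self_of_nhds]

/-- `covDerivAlong` contains `D` applied to an extension of `V x`, so its linearity in `V` requires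
the germ of the extension to be linear in the vector. This holds over the base set of the
trivialization. -/
theorem extend_add (x : M') (v w : TangentSpace I' x) :
    ∀ᶠ y in 𝓝 x, FiberBundle.extend (E := fun y : M' ↦ TangentSpace I' y) E' (v + w) y =
      (FiberBundle.extend (E := fun y : M' ↦ TangentSpace I' y) E' v +
        FiberBundle.extend (E := fun y : M' ↦ TangentSpace I' y) E' w) y := by
  let e := trivializationAt E' (fun y : M' ↦ TangentSpace I' y) x
  have hx : x ∈ e.baseSet := FiberBundle.mem_baseSet_trivializationAt' x
  filter_upwards [e.open_baseSet.mem_nhds hx] with y hy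
  have h (u : TangentSpace I' x) : FiberBundle.extend (E := fun y : M' ↦ TangentSpace I' y) E' u y =
      e.symmL ℝ y (e.continuousLinearMapAt ℝ x u) := by
    rw [e.symmL_apply (R := ℝ) hy, e.continuousLinearMapAt_apply ℝ, e.coe_linearMapAt_of_mem hx]
    rfl
  simp only [Pi.add_apply, h, map_add]

theorem extend_smul (x : M') (c : ℝ) (v : TangentSpace I' x) :
    ∀ᶠ y in 𝓝 x, FiberBundle.extend (E := fun y : M' ↦ TangentSpace I' y) E' (c • v) y =
      (c • FiberBundle.extend (E := fun y : M' ↦ TangentSpace I' y) E' v) y := by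
  let e := trivializationAt E' (fun y : M' ↦ TangentSpace I' y) x
  have hx : x ∈ e.baseSet := FiberBundle.mem_baseSet_trivializationAt' x
  filter_upwards [e.open_baseSet.mem_nhds hx] with y hy
  have h (u : TangentSpace I' x) : FiberBundle.extend (E := fun y : M' ↦ TangentSpace I' y) E' u y =
      e.symmL ℝ y (e.continuousLinearMapAt ℝ x u) := by
    rw [e.symmL_apply (R := ℝ) hy, e.continuousLinearMapAt_apply ℝ, e.coe_linearMapAt_of_mem hx]
    rfl
  simp only [Pi.smul_apply, h, map_smul]

variable (D : CovariantDerivative I' E' (fun y : M' ↦ TangentSpace I' y))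

theorem covDeriv_extend_add (x : M') (v w : TangentSpace I' x) :
    D (FiberBundle.extend E' (v + w)) x =
      D (FiberBundle.extend E' v) x + D (FiberBundle.extend E' w) x := by
  have h (u : TangentSpace I' x) := FiberBundle.mdifferentiableAt_extend I' E' u
  rw [← D.isCovariantDerivativeOnUniv.add (h v) (h w)]
  exact D.isCovariantDerivativeOnUniv.congr_of_eventuallyEq (h _)
    (mdifferentiableAt_add_section (h v) (h w)) Filter.univ_mem (extend_add x v w)

theorem covDeriv_extend_smul (x : M') (c : ℝ) (v : TangentSpace I' x) :
    D (FiberBundle.extend E' (c • v)) x = c • D (FiberBundle.extend E' v) x := by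
  have h (u : TangentSpace I' x) := FiberBundle.mdifferentiableAt_extend I' E' u
  rw [← D.isCovariantDerivativeOnUniv.smul_const c (h v)]
  exact D.isCovariantDerivativeOnUniv.congr_of_eventuallyEq (h _)
    (MDifferentiableAt.smul_const_section (h v)) Filter.univ_mem (extend_smul x c v)

theorem covDerivAlong_apply (V : Π x : M, TangentSpace I' (i x)) (x : M) (v : TangentSpace I x) :
    covDerivAlong I D i V x v =
      (trivializationAt E' (fun y : M' ↦ TangentSpace I' y) (i x)).symmL ℝ (i x)
        (mvfderiv I (alongCoord I' V x) x v)
      + D (FiberBundle.extend E' (V x)) (i x) (mfderiv I I' i x v) := rfl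

theorem covDerivAlong_congr (h : ∀ᶠ y in 𝓝 x, V y = W y) (v : TangentSpace I x) :
    covDerivAlong I D i V x v = covDerivAlong I D i W x v := by
  rw [covDerivAlong_apply, covDerivAlong_apply, mvfderiv_congr (alongCoord_congr h) v,
    h.self_of_nhds]

theorem covDerivAlong_add (hV : MDiffAlongAt I I' V x) (hW : MDiffAlongAt I I' W x)
    (v : TangentSpace I x) :
    covDerivAlong I D i (fun y ↦ V y + W y) x v =
      covDerivAlong I D i V x v + covDerivAlong I D i W x v := by
  simp only [covDerivAlong_apply]
  rw [mvfderiv_congr (alongCoord_add hV.base) v, mvfderiv_add hV.coord hW.coord,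
    covDeriv_extend_add]
  simp only [add_apply, map_add]
  abel

theorem covDerivAlong_smul {f : M → ℝ} (hf : MDifferentiableAt I 𝓘(ℝ, ℝ) f x)
    (hV : MDiffAlongAt I I' V x) (v : TangentSpace I x) :
    covDerivAlong I D i (fun y ↦ f y • V y) x v =
      mvfderiv I f x v • V x + f x • covDerivAlong I D i V x v := by
  let e := trivializationAt E' (fun y : M' ↦ TangentSpace I' y) (i x)
  have hx : i x ∈ e.baseSet := FiberBundle.mem_baseSet_trivializationAt' (i x)
  have h : e.symmL ℝ (i x) (alongCoord I' V x x) = V x := by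
    rw [alongCoord_eq hx]
    exact e.symmL_continuousLinearMapAt hx _
  simp only [covDerivAlong_apply]
  rw [mvfderiv_congr (alongCoord_smul hV.base f) v, mvfderiv_smul hf hV.coord,
    covDeriv_extend_smul]
  simp only [add_apply, map_add, smul_apply, map_smul,
    ContinuousLinearMap.smulRight_apply, smul_add]
  rw [h]
  abel

/-- A covariant derivative, in a local trivialization. -/
theorem covDeriv_eq_covDerivAlong_id {s : Π y : M', TangentSpace I' y} {y : M'}
    (hs : MDifferentiableAt I' I'.tangent (fun y ↦ (⟨y, s y⟩ : TangentBundle I' M')) y)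
    (v : TangentSpace I' y) : D s y v = covDerivAlong I' D (fun y ↦ y) s y v := by
  -- Both expressions satisfy the same Leibniz rule, so their difference depends only on `s y`, and
  -- `s` may be replaced by its extension with constant coefficients.
  have hΦ : TensorialAt I' E' (fun s : Π y : M', TangentSpace I' y ↦
      D s y v - covDerivAlong I' D (fun y ↦ y) s y v) y :=
    { smul := by
        intro f σ hf hσ
        have h1 := covDerivAlong_smul (i := fun y : M' ↦ y) D hf hσ v
        have h2 := D.isCovariantDerivativeOnUniv.leibniz hσ hf
        have h3 : D.toFun (f • σ) y v = f y • D.toFun σ y v + mvfderiv I' f y v • σ y := by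
          rw [h2]; rfl
        have h4 : covDerivAlong I' D (fun y ↦ y) (f • σ) y v =
          mvfderiv I' f y v • σ y + f y • covDerivAlong I' D (fun y ↦ y) σ y v := h1
        simp only [h3, h4, smul_sub]
        abel
      add := by
        intro σ τ hσ hτ
        have h1 := covDerivAlong_add (i := fun y : M' ↦ y) D hσ hτ v
        have h2 := D.isCovariantDerivativeOnUniv.add hσ hτ
        have h3 : D.toFun (σ + τ) y v = D.toFun σ y v + D.toFun τ y v := by rw [h2]; rfl
        have h4 : covDerivAlong I' D (fun y ↦ y) (σ + τ) y v =
          covDerivAlong I' D (fun y ↦ y) σ y v + covDerivAlong I' D (fun y ↦ y) τ y v := h1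
        simp only [h3, h4]
        abel }
  have h1 := hΦ.pointwise hs (FiberBundle.mdifferentiableAt_extend I' E' (s y)) (by simp)
  have h2 : covDerivAlong I' D (fun y ↦ y) (FiberBundle.extend E' (s y)) y v =
      D (FiberBundle.extend E' (s y)) y v := by
    rw [covDerivAlong_apply]
    -- The coefficients of the extension are constant near `y`, so the coordinate term vanishes and
    -- only `D` of the extension remains.
    have h3 : alongCoord I' (i := fun y : M' ↦ y) (FiberBundle.extend E' (s y)) y =ᶠ[𝓝 y]
        fun _ ↦ (trivializationAt E' (fun y : M' ↦ TangentSpace I' y) y ⟨y, s y⟩).2 := by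
      filter_upwards [eventually_mem_baseSet (mdifferentiableAt_id (I := I') (x := y))] with z hz
      have hz' : z ∈ (trivializationAt E' (fun y : M' ↦ TangentSpace I' y) y).baseSet := hz
      simp [alongCoord, FiberBundle.extend,
        Trivialization.apply_mk_symm _ hz']
    rw [mvfderiv_congr h3 v, mvfderiv_const]
    have h4 : mfderiv I' I' (fun y : M' ↦ y) y v = v := 
      DFunLike.congr_fun (mfderiv_id (I := I') (x := y)) v
    simp [h4]
  rw [h2, sub_self] at h1
  exact sub_eq_zero.1 h1

/-- In the trivialization at `i x`, the coordinates of `s ∘ i` are those of `s` composed with `i`,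
so this is the ordinary chain rule. It settles the generating case of `MDiffAlongAt.induction`. -/
theorem covDerivAlong_comp {s : Π y : M', TangentSpace I' y}
    (hs : MDifferentiableAt I' I'.tangent (fun y ↦ (⟨y, s y⟩ : TangentBundle I' M')) (i x))
    (hi : MDifferentiableAt I I' i x) (v : TangentSpace I x) :
    covDerivAlong I D i (fun y ↦ s (i y)) x v = D s (i x) (mfderiv I I' i x v) := by
  rw [covDeriv_eq_covDerivAlong_id D hs, covDerivAlong_apply, covDerivAlong_apply]
  have h1 (w : TangentSpace I' (i x)) : mfderiv I' I' (fun y : M' ↦ y) (i x) w = w :=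
    DFunLike.congr_fun (mfderiv_id (I := I') (x := i x)) w
  have h2 : MDifferentiableAt I' 𝓘(ℝ, E') (alongCoord I' (i := fun y : M' ↦ y) s (i x)) (i x) :=
    MDiffAlongAt.coord (i := fun y : M' ↦ y) (x := i x) hs
  have h : alongCoord I' (fun y ↦ s (i y)) x =
      alongCoord I' (i := fun y : M' ↦ y) s (i x) ∘ i := rfl
  have h3 : mvfderiv I (alongCoord I' (i := fun y : M' ↦ y) s (i x) ∘ i) x v =
      mvfderiv I' (alongCoord I' (i := fun y : M' ↦ y) s (i x)) (i x) (mfderiv I I' i x v) :=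
    mfderiv_comp_apply x h2 hi v
  rw [h, h3, h1]

variable [RiemannianBundle (fun y : M' ↦ TangentSpace I' y)]
  [IsContMDiffRiemannianBundle I' ∞ E' (fun y : M' ↦ TangentSpace I' y)]

theorem MDiffAlongAt.inner (hV : MDiffAlongAt I I' V x) (hW : MDiffAlongAt I I' W x) :
    MDifferentiableAt I 𝓘(ℝ, ℝ) (fun y ↦ (inner ℝ (V y) (W y) : ℝ)) x := by
  have : IsContMDiffRiemannianBundle I' 1 E' (fun y : M' ↦ TangentSpace I' y) :=
    .of_le (n := ∞) (by simp)
  exact MDifferentiableAt.inner_bundle (IB := I') (F := E')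
    (E := fun y : M' ↦ TangentSpace I' y) hV hW

theorem mvfderiv_inner_along (hD : IsLeviCivita D) (hV : MDiffAlongAt I I' V x)
    (hW : MDiffAlongAt I I' W x) (v : TangentSpace I x) :
    mvfderiv I (fun y ↦ (inner ℝ (V y) (W y) : ℝ)) x v =
      inner ℝ (covDerivAlong I D i V x v) (W x) + inner ℝ (V x) (covDerivAlong I D i W x v) := by
  -- `W` is quantified inside the motive: the first induction reduces `V` to a restricted field, a
  -- second one does the same for `W`, and then metric compatibility on `M'` and the chain rule
  -- apply.
  refine MDiffAlongAt.induction (p := fun V ↦ ∀ W : Π x : M, TangentSpace I' (i x),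
    MDiffAlongAt I I' W x → mvfderiv I (fun y ↦ (inner ℝ (V y) (W y) : ℝ)) x v =
      inner ℝ (covDerivAlong I D i V x v) (W x) + inner ℝ (V x) (covDerivAlong I D i W x v))
    ?_ ?_ ?_ ?_ hV W hW
  · intro V V' hV h ih W hW
    rw [covDerivAlong_congr D h, h.self_of_nhds, ← ih W hW]
    refine mvfderiv_congr ?_ v
    filter_upwards [h] with y hy
    rw [hy]
  · intro V V' hV hV' ih ih' W hW
    rw [covDerivAlong_add D hV hV']
    simp only [inner_add_left]
    have := mvfderiv_add (hV.inner hW) (hV'.inner hW)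
    have h2 := congrArg (fun L ↦ L v) this
    simp only [add_apply] at h2
    refine Eq.trans h2 ?_
    rw [ih W hW, ih' W hW]
    abel
  · intro f V hf hV ih W hW
    rw [covDerivAlong_smul D hf hV]
    simp only [inner_add_left, real_inner_smul_left]
    have := mvfderiv_mul hf (hV.inner hW)
    have h2 := congrArg (fun L ↦ L v) this
    simp only [add_apply, smul_apply] at h2
    refine Eq.trans h2 ?_
    rw [ih W hW]
    simp only [smul_eq_mul]
    ring
  · intro s hs W hW
    have hs' := hs.mdifferentiableAt (by simp)
    have hi := hW.base
    have hsi := MDiffAlongAt.comp hs' hi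
    refine MDiffAlongAt.induction (p := fun W ↦
      mvfderiv I (fun y ↦ (inner ℝ (s (i y)) (W y) : ℝ)) x v =
        inner ℝ (covDerivAlong I D i (fun y ↦ s (i y)) x v) (W x) +
          inner ℝ (s (i x)) (covDerivAlong I D i W x v)) ?_ ?_ ?_ ?_ hW
    · intro W W' hW h ih
      rw [covDerivAlong_congr D h, h.self_of_nhds, ← ih]
      refine mvfderiv_congr ?_ v
      filter_upwards [h] with y hy
      rw [hy]
    · intro W W' hW hW' ih ih'
      rw [covDerivAlong_add D hW hW']
      simp only [inner_add_right]
      have := mvfderiv_add (hsi.inner hW) (hsi.inner hW')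
      have h2 := congrArg (fun L ↦ L v) this
      simp only [add_apply] at h2
      refine Eq.trans h2 ?_
      rw [ih, ih']
      abel
    · intro f W hf hW ih
      rw [covDerivAlong_smul D hf hW]
      simp only [inner_add_right, real_inner_smul_right]
      have := mvfderiv_mul hf (hsi.inner hW)
      have h2 := congrArg (fun L ↦ L v) this
      simp only [add_apply, smul_apply] at h2
      refine Eq.trans h2 ?_
      rw [ih]
      simp only [smul_eq_mul]
      ring
    · intro t ht
      have ht' := ht.mdifferentiableAt (by simp)
      rw [covDerivAlong_comp D hs' hi, covDerivAlong_comp D ht' hi]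
      rw [← hD.metric (i x) _ s t hs' ht']
      exact mvfderiv_comp_apply (g := fun y ↦ (inner ℝ (s y) (t y) : ℝ)) x
        (MDiffAlongAt.inner (i := fun y : M' ↦ y) hs' ht') hi v

theorem MDiffAlongAt.clm {J : Π y : M', TangentSpace I' y →L[ℝ] TangentSpace I' y}
    (hJ : IsSmoothEndomorphismField I' J) (hV : MDiffAlongAt I I' V x) :
    MDiffAlongAt I I' (fun y ↦ J (i y) (V y)) x := by
  have h : MDifferentiableAt I (I'.prod 𝓘(ℝ, E' →L[ℝ] E'))
      (fun y ↦ TotalSpace.mk' (E' →L[ℝ] E')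
        (E := fun y : M' ↦ TangentSpace I' y →L[ℝ] TangentSpace I' y) (i y) (J (i y))) x :=
    MDifferentiableAt.comp x (hJ.mdifferentiable (by simp) (i x)) hV.base
  exact MDifferentiableAt.clm_bundle_apply (F₁ := E') (F₂ := E')
    (E₁ := fun y : M' ↦ TangentSpace I' y) (E₂ := fun y : M' ↦ TangentSpace I' y) h hV

/-- Both sides obey the same sum and Leibniz rules in `V`, because `J` is fibrewise linear; on
restrictions of smooth fields the claim is `∇J = 0`. -/
theorem covDerivAlong_clm {p q : ℕ} {J : Π y : M', TangentSpace I' y →L[ℝ] TangentSpace I' y}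
    (hJ : IsLocallyMetallic p q D J) (hV : MDiffAlongAt I I' V x) (v : TangentSpace I x) :
    covDerivAlong I D i (fun y ↦ J (i y) (V y)) x v =
      J (i x) (covDerivAlong I D i V x v) := by
  have hi := hV.base
  refine MDiffAlongAt.induction (p := fun V ↦
    covDerivAlong I D i (fun y ↦ J (i y) (V y)) x v = J (i x) (covDerivAlong I D i V x v))
    ?_ ?_ ?_ ?_ hV
  · intro V V' hV h ih
    rw [covDerivAlong_congr D h, ← ih]
    refine covDerivAlong_congr D ?_ v
    filter_upwards [h] with y hy
    rw [hy]
  · intro V V' hV hV' ih ih'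
    simp only [map_add]
    rw [covDerivAlong_add D hV hV', covDerivAlong_add D (hV.clm hJ.smooth) (hV'.clm hJ.smooth),
      ih, ih', map_add]
  · intro f V hf hV ih
    simp only [map_smul]
    rw [covDerivAlong_smul D hf hV, covDerivAlong_smul D hf (hV.clm hJ.smooth), ih, map_add,
      map_smul, map_smul]
  · intro s hs
    have hs' := hs.mdifferentiableAt (by simp)
    rw [covDerivAlong_comp D hs' hi, covDerivAlong_comp (s := fun y ↦ J y (s y)) D
      (MDiffAlongAt.clm (i := fun y : M' ↦ y) hJ.smooth hs') hi, hJ.parallel (i x) s hs]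

end CovDerivAlong

/-! ### Push-forward of vector fields and the torsion identity along `i` -/

section Pushforward

variable {E : Type*} [NormedAddCommGroup E] [NormedSpace ℝ E] [FiniteDimensional ℝ E]
  {H : Type*} [TopologicalSpace H] {I : ModelWithCorners ℝ E H}
  {M : Type*} [TopologicalSpace M] [ChartedSpace H M] [IsManifold I ∞ M]
  {E' : Type*} [NormedAddCommGroup E'] [NormedSpace ℝ E'] [FiniteDimensional ℝ E']
  {H' : Type*} [TopologicalSpace H'] {I' : ModelWithCorners ℝ E' H'}
  {M' : Type*} [TopologicalSpace M'] [ChartedSpace H' M'] [IsManifold I' ∞ M']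
  {i : M → M'} {x : M}

theorem extend_eq_symmL (x : M) (v : TangentSpace I x) {y : M} (hy : y ∈ (chartAt H x).source) :
    FiberBundle.extend (E := fun y : M ↦ TangentSpace I y) E v y =
      (trivializationAt E (fun y : M ↦ TangentSpace I y) x).symmL ℝ y
        (mfderiv I 𝓘(ℝ, E) (extChartAt I x) x v) := by
  let e := trivializationAt E (fun y : M ↦ TangentSpace I y) x
  have hx : x ∈ e.baseSet := FiberBundle.mem_baseSet_trivializationAt' x
  have hy' : y ∈ e.baseSet := hy
  have h : FiberBundle.extend (E := fun y : M ↦ TangentSpace I y) E v y =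
      e.symmL ℝ y (e.continuousLinearMapAt ℝ x v) := by
    rw [e.symmL_apply (R := ℝ) hy', e.continuousLinearMapAt_apply ℝ, e.coe_linearMapAt_of_mem hx]
    rfl
  exact h.trans (congrArg (e.symmL ℝ y) (DFunLike.congr_fun
    (TangentBundle.continuousLinearMapAt_trivializationAt (mem_chart_source H x)) v))

/-- The extensions of tangent vectors at `x` by constant coefficients commute. -/
theorem mlieBracket_extend (x : M) (v w : TangentSpace I x) :
    VectorField.mlieBracket I (FiberBundle.extend (E := fun y : M ↦ TangentSpace I y) E v)
      (FiberBundle.extend (E := fun y : M ↦ TangentSpace I y) E w) x = 0 := by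
  -- Read in the chart at `x`, an extension is a constant vector field, and constant fields have
  -- zero bracket.
  have key (u : TangentSpace I x) :
      VectorField.mpullbackWithin 𝓘(ℝ, E) I (extChartAt I x).symm
        (FiberBundle.extend (E := fun y : M ↦ TangentSpace I y) E u) (Set.range I)
        =ᶠ[𝓝[Set.range I] (extChartAt I x x)]
      fun _ ↦ (mfderiv I 𝓘(ℝ, E) (extChartAt I x) x u : E) := by
    filter_upwards [extChartAt_target_mem_nhdsWithin (I := I) x] with z hz
    have hz' : (extChartAt I x).symm z ∈ (chartAt H x).source := by
      rw [← extChartAt_source I]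
      exact (extChartAt I x).map_target hz
    rw [VectorField.mpullbackWithin, extend_eq_symmL x u hz',
      TangentBundle.symmL_trivializationAt hz', (extChartAt I x).right_inv hz]
    exact DFunLike.congr_fun
      (isInvertible_mfderivWithin_extChartAt_symm (I := I) hz).inverse_comp_self _
  rw [← VectorField.mlieBracketWithin_univ, VectorField.mlieBracketWithin_apply, Set.preimage_univ,
    Set.univ_inter, (key v).lieBracketWithin_vectorField_eq_of_mem (key w) (Set.mem_range_self _)]
  have hconst (a b : E) (s : Set E) (z : E) :
      VectorField.lieBracketWithin ℝ (fun _ ↦ a) (fun _ ↦ b) s z = 0 := by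
    simp [VectorField.lieBracketWithin]
  exact (congrArg _ (hconst _ _ _ _)).trans (map_zero _)

theorem mdiffAlongAt_mfderiv (hi : ContMDiff I I' ∞ i) {X : Π x : M, TangentSpace I x}
    (hX : MDifferentiableAt I I.tangent (fun y ↦ (⟨y, X y⟩ : TangentBundle I M)) x) :
    MDiffAlongAt I I' (fun y ↦ mfderiv I I' i y (X y)) x := by
  have h : ContMDiff I.tangent I'.tangent 1 (tangentMap I I' i) :=
    hi.contMDiff_tangentMap (by norm_cast)
  exact MDifferentiableAt.comp x (h.mdifferentiable (by simp) _) hX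

theorem alongCoord_mfderiv (hi : ContMDiff I I' ∞ i) (X : Π x : M, TangentSpace I x) :
    ∀ᶠ y in 𝓝 x, alongCoord I' (fun y ↦ mfderiv I I' i y (X y)) x y =
      inTangentCoordinates I I' id i (mfderiv I I' i) x y
        (alongCoord I (i := fun y : M ↦ y) X x y) := by
  have hi' : MDifferentiableAt I I' i x := hi.mdifferentiable (by simp) x
  have hid : MDifferentiableAt I I (fun y : M ↦ y) x := mdifferentiableAt_id
  filter_upwards [eventually_mem_baseSet hi', eventually_mem_baseSet hid] with y hy hy'
  rw [alongCoord_eq hy, alongCoord_eq (i := fun y : M ↦ y) hy']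
  -- Passing `X y` through the trivialization of `TM` and back exposes the differential of `i` in
  -- tangent coordinates.
  have := (trivializationAt E (fun y : M ↦ TangentSpace I y) x).symmL_continuousLinearMapAt
    (R := ℝ) hy' (X y)
  conv_lhs => rw [← this]
  rfl

/-- A vector field `X` on `M` is differentiable if `i_* X` is, when `i` is an immersion. -/
theorem MDiffAlongAt.of_mfderiv (hi : ContMDiff I I' ∞ i)
    (hinj : Function.Injective (mfderiv I I' i x)) {X : Π x : M, TangentSpace I x}
    (hX : MDiffAlongAt I I' (fun y ↦ mfderiv I I' i y (X y)) x) :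
    MDifferentiableAt I I.tangent (fun y ↦ (⟨y, X y⟩ : TangentBundle I M)) x := by
  have hid : MDifferentiableAt I I (fun y : M ↦ y) x := mdifferentiableAt_id
  let A : M → E →L[ℝ] E' := inTangentCoordinates I I' id i (mfderiv I I' i) x
  have hA : MDifferentiableAt I 𝓘(ℝ, E →L[ℝ] E') A x :=
    ((hi x).mfderiv_const (m := 1) (by norm_cast)).mdifferentiableAt (by simp)
  have hAinj : Function.Injective (A x) := by
    have hx := FiberBundle.mem_baseSet_trivializationAt' (F := E)
      (E := fun y : M ↦ TangentSpace I y) x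
    have hix := FiberBundle.mem_baseSet_trivializationAt' (F := E')
      (E := fun y : M' ↦ TangentSpace I' y) (i x)
    intro v w hvw
    have h0 (u : E) : A x u = ((trivializationAt E' (fun y : M' ↦ TangentSpace I' y)
        (i x)).continuousLinearEquivAt ℝ (i x) hix) (mfderiv I I' i x
          ((trivializationAt E (fun y : M ↦ TangentSpace I y) x).symmL ℝ x u)) := by
      rw [Trivialization.coe_continuousLinearEquivAt_eq]
      rfl
    rw [h0, h0] at hvw
    have h1 := hinj (ContinuousLinearEquiv.injective _ hvw)
    have h2 := congrArg ((trivializationAt E (fun y : M ↦ TangentSpace I y)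
      x).continuousLinearMapAt ℝ x) h1
    rwa [Trivialization.continuousLinearMapAt_symmL _ hx,
      Trivialization.continuousLinearMapAt_symmL _ hx] at h2
  -- A left inverse `L` of the coordinate differential at the single point `x` suffices: `B y = L ∘
  -- A y` is the identity at `x`, hence invertible nearby. The coordinates of `X` are then `B⁻¹ L`
  -- applied to those of `i_* X`, and inversion is differentiable.
  obtain ⟨L, hL⟩ := LinearMap.exists_leftInverse_of_injective (A x : E →ₗ[ℝ] E')
    (LinearMap.ker_eq_bot.2 hAinj)
  let L' : E' →L[ℝ] E := LinearMap.toContinuousLinearMap L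
  let B : M → E →L[ℝ] E := fun y ↦ L' ∘L A y
  have hB : MDifferentiableAt I 𝓘(ℝ, E →L[ℝ] E) B x :=
    (mdifferentiableAt_const (c := L')).clm_comp hA
  have hBx : B x = 1 := by
    ext v
    exact DFunLike.congr_fun hL v
  have hunit : ∀ᶠ y in 𝓝 x, IsUnit (B y) := by
    have : CompleteSpace E := FiniteDimensional.complete ℝ E
    have h1 : ∀ᶠ C in 𝓝 (B x), IsUnit C := by
      rw [hBx]
      exact Units.isOpen.mem_nhds isUnit_one
    exact hB.continuousAt.eventually h1
  have hinv : MDifferentiableAt I 𝓘(ℝ, E →L[ℝ] E) (fun y ↦ Ring.inverse (B y)) x := by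
    have : CompleteSpace E := FiniteDimensional.complete ℝ E
    have h1 : DifferentiableAt ℝ (Ring.inverse : (E →L[ℝ] E) → E →L[ℝ] E) (B x) :=
      differentiableAt_inverse (by rw [hBx]; exact isUnit_one)
    exact h1.comp_mdifferentiableAt hB
  refine (mdiffAlongAt_iff (i := fun y : M ↦ y)).2 ⟨hid, ?_⟩
  have h2 : MDifferentiableAt I 𝓘(ℝ, E) (fun y ↦ Ring.inverse (B y)
      (L' (alongCoord I' (fun y ↦ mfderiv I I' i y (X y)) x y))) x :=
    hinv.clm_apply ((mdifferentiableAt_const (c := L')).clm_apply hX.coord)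
  refine h2.congr_of_eventuallyEq ?_
  filter_upwards [alongCoord_mfderiv (x := x) hi X, hunit] with y hy hu
  rw [hy]
  exact (DFunLike.congr_fun (Ring.inverse_mul_cancel (B y) hu) _).symm

variable [I.Boundaryless]

/-- By the chain rule for `i` in charts, pushing forward a constant-coefficient field gives a
directional derivative of the chart expression. Without boundary the model range is the whole space,
so `fderiv` can be used. -/
theorem alongCoord_mfderiv_extend (hi : ContMDiff I I' ∞ i) (v : TangentSpace I x) :
    ∀ᶠ y in 𝓝 x,
      alongCoord I' (fun y ↦ mfderiv I I' i y
        (FiberBundle.extend (E := fun y : M ↦ TangentSpace I y) E v y)) x y =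
      fderiv ℝ (writtenInExtChartAt I I' x i) (extChartAt I x y)
        (mfderiv I 𝓘(ℝ, E) (extChartAt I x) x v) := by
  have hi' : MDifferentiableAt I I' i x := hi.mdifferentiable (by simp) x
  filter_upwards [eventually_mem_baseSet hi', (chartAt H x).open_source.mem_nhds
    (mem_chart_source H x)] with y hy hy'
  have hy2 : i y ∈ (chartAt H' (i x)).source := hy
  have hy3 : y ∈ (extChartAt I x).source := by rwa [extChartAt_source]
  have hinv := (extChartAt I x).left_inv hy3
  have ht := (extChartAt I x).map_source hy3
  have hr : Set.range I = Set.univ := I.range_eq_univ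
  rw [alongCoord_eq hy, extend_eq_symmL x v hy', TangentBundle.symmL_trivializationAt hy',
    TangentBundle.continuousLinearMapAt_trivializationAt hy2]
  have h1 : HasMFDerivAt 𝓘(ℝ, E) I (extChartAt I x).symm (extChartAt I x y)
      (mfderivWithin 𝓘(ℝ, E) I (extChartAt I x).symm (Set.range I) (extChartAt I x y)) := by
    have := (mdifferentiableWithinAt_extChartAt_symm ht).hasMFDerivWithinAt
    rw [hr] at this ⊢
    exact hasMFDerivWithinAt_univ.1 this
  have h2 : HasMFDerivAt I I' i ((extChartAt I x).symm (extChartAt I x y)) (mfderiv I I' i y) := by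
    rw [hinv]
    exact (hi.mdifferentiable (by simp) y).hasMFDerivAt
  have h3 : HasMFDerivAt I' 𝓘(ℝ, E') (extChartAt I' (i x))
      ((i ∘ (extChartAt I x).symm) (extChartAt I x y))
      (mfderiv I' 𝓘(ℝ, E') (extChartAt I' (i x)) (i y)) := by
    rw [Function.comp_apply, hinv]
    exact (mdifferentiableAt_extChartAt hy2).hasMFDerivAt
  let L : E →L[ℝ] E' := (mfderiv I' 𝓘(ℝ, E') (extChartAt I' (i x)) (i y)) ∘L
    (mfderiv I I' i y) ∘L
      (mfderivWithin 𝓘(ℝ, E) I (extChartAt I x).symm (Set.range I) (extChartAt I x y))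
  have h4 : HasFDerivAt (writtenInExtChartAt I I' x i) L (extChartAt I x y) :=
    hasMFDerivAt_iff_hasFDerivAt.1 (h3.comp _ (h2.comp _ h1))
  rw [h4.fderiv]
  rfl

/-- Both sides are the second derivative of the chart expression of `i` on the same two vectors,
which is symmetric. -/
theorem mvfderiv_alongCoord_extend_comm (hi : ContMDiff I I' ∞ i) (v w : TangentSpace I x) :
    mvfderiv I (alongCoord I' (fun y ↦ mfderiv I I' i y
        (FiberBundle.extend (E := fun y : M ↦ TangentSpace I y) E v y)) x) x w =
      mvfderiv I (alongCoord I' (fun y ↦ mfderiv I I' i y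
        (FiberBundle.extend (E := fun y : M ↦ TangentSpace I y) E w y)) x) x v := by
  let F := writtenInExtChartAt I I' x i
  have hF : ContDiffAt ℝ ∞ F (extChartAt I x x) := by
    have := (contMDiffAt_iff.1 (hi x)).2
    rwa [I.range_eq_univ, contDiffWithinAt_univ] at this
  have hF' : DifferentiableAt ℝ (fderiv ℝ F) (extChartAt I x x) :=
    (hF.fderiv_right (m := 1) (by norm_cast)).differentiableAt (by simp)
  have hsymm : IsSymmSndFDerivAt ℝ F (extChartAt I x x) :=
    hF.isSymmSndFDerivAt (by
      rw [minSmoothness_of_isRCLikeNormedField]; norm_cast)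
  let dφ : TangentSpace I x → E := fun u ↦ mfderiv I 𝓘(ℝ, E) (extChartAt I x) x u
  have key (u u' : TangentSpace I x) :
      mvfderiv I (alongCoord I' (fun y ↦ mfderiv I I' i y
        (FiberBundle.extend (E := fun y : M ↦ TangentSpace I y) E u y)) x) x u' =
      fderiv ℝ (fderiv ℝ F) (extChartAt I x x) (dφ u')
        (dφ u) := by
    rw [mvfderiv_congr (alongCoord_mfderiv_extend hi u) u']
    have h1 : HasFDerivAt (fun z ↦ fderiv ℝ F z (dφ u))
        ((ContinuousLinearMap.apply ℝ E' (dφ u)) ∘L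
          (fderiv ℝ (fderiv ℝ F) (extChartAt I x x))) (extChartAt I x x) :=
      (ContinuousLinearMap.apply ℝ E' (dφ u)).hasFDerivAt.comp _ hF'.hasFDerivAt
    have h2 := h1.hasMFDerivAt.comp x 
      (mdifferentiableAt_extChartAt (I := I) (mem_chart_source H x)).hasMFDerivAt
    have h3 := DFunLike.congr_fun h2.mfderiv u'
    exact h3
  rw [key, key]
  exact hsymm _ _

variable (D : CovariantDerivative I' E' (fun y : M' ↦ TangentSpace I' y))

theorem covDerivAlong_mfderiv_sub (hD : D.torsion = 0) (hi : ContMDiff I I' ∞ i)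
    {X Y : Π x : M, TangentSpace I x}
    (hX : MDifferentiableAt I I.tangent (fun y ↦ (⟨y, X y⟩ : TangentBundle I M)) x)
    (hY : MDifferentiableAt I I.tangent (fun y ↦ (⟨y, Y y⟩ : TangentBundle I M)) x) :
    covDerivAlong I D i (fun y ↦ mfderiv I I' i y (Y y)) x (X x)
      - covDerivAlong I D i (fun y ↦ mfderiv I I' i y (X y)) x (Y x)
      = mfderiv I I' i x (VectorField.mlieBracket I X Y x) := by
  have hsmul {f : M → ℝ} {X : Π x : M, TangentSpace I x} (hf : MDifferentiableAt I 𝓘(ℝ, ℝ) f x)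
      (hX : MDifferentiableAt I I.tangent (fun y ↦ (⟨y, X y⟩ : TangentBundle I M)) x)
      (v : TangentSpace I x) :
      covDerivAlong I D i (fun y ↦ mfderiv I I' i y ((f • X) y)) x v =
        mvfderiv I f x v • mfderiv I I' i x (X x) +
          f x • covDerivAlong I D i (fun y ↦ mfderiv I I' i y (X y)) x v := by
    rw [← covDerivAlong_smul D hf (mdiffAlongAt_mfderiv hi hX)]
    simp only [Pi.smul_apply', map_smul]
  have hadd {X X' : Π x : M, TangentSpace I x}
      (hX : MDifferentiableAt I I.tangent (fun y ↦ (⟨y, X y⟩ : TangentBundle I M)) x)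
      (hX' : MDifferentiableAt I I.tangent (fun y ↦ (⟨y, X' y⟩ : TangentBundle I M)) x)
      (v : TangentSpace I x) :
      covDerivAlong I D i (fun y ↦ mfderiv I I' i y ((X + X') y)) x v =
        covDerivAlong I D i (fun y ↦ mfderiv I I' i y (X y)) x v +
          covDerivAlong I D i (fun y ↦ mfderiv I I' i y (X' y)) x v := by
    rw [← covDerivAlong_add D (mdiffAlongAt_mfderiv hi hX) (mdiffAlongAt_mfderiv hi hX')]
    simp only [Pi.add_apply, map_add]
  -- The defect of the identity is tensorial in both fields: the derivative terms of the Leibniz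
  -- rules cancel those of the bracket. It can therefore be evaluated on constant-coefficient
  -- extensions.
  let Φ : (Π x : M, TangentSpace I x) → (Π x : M, TangentSpace I x) → TangentSpace I' (i x) :=
    fun X Y ↦ covDerivAlong I D i (fun y ↦ mfderiv I I' i y (Y y)) x (X x)
      - covDerivAlong I D i (fun y ↦ mfderiv I I' i y (X y)) x (Y x)
      - mfderiv I I' i x (VectorField.mlieBracket I X Y x)
  have hΦ₁ (τ : Π x : M, TangentSpace I x)
      (hτ : MDifferentiableAt I I.tangent (fun y ↦ (⟨y, τ y⟩ : TangentBundle I M)) x) :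
      TensorialAt I E (Φ · τ) x :=
    { smul := by
        intro f σ hf hσ
        simp only [Φ]
        rw [hsmul hf hσ, VectorField.mlieBracket_smul_left hf hσ]
        simp only [Pi.smul_apply',
          map_smul, map_add]
        module
      add := by
        intro σ σ' hσ hσ'
        simp only [Φ]
        rw [hadd hσ hσ', VectorField.mlieBracket_add_left hσ hσ']
        simp only [Pi.add_apply, map_add]
        module }
  have hΦ₂ (σ : Π x : M, TangentSpace I x)
      (hσ : MDifferentiableAt I I.tangent (fun y ↦ (⟨y, σ y⟩ : TangentBundle I M)) x) :
      TensorialAt I E (Φ σ ·) x :=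
    { smul := by
        intro f τ hf hτ
        simp only [Φ]
        rw [hsmul hf hτ, VectorField.mlieBracket_smul_right hf hτ]
        simp only [Pi.smul_apply',
          map_smul, map_add]
        module
      add := by
        intro τ τ' hτ hτ'
        simp only [Φ]
        rw [hadd hτ hτ', VectorField.mlieBracket_add_right hτ hτ']
        simp only [Pi.add_apply, map_add]
        module }
  have h1 : Φ X Y = Φ (FiberBundle.extend E (X x)) (FiberBundle.extend E (Y x)) :=
    TensorialAt.pointwise₂ hΦ₁ hΦ₂ hX (FiberBundle.mdifferentiableAt_extend I E (X x)) hY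
      (FiberBundle.mdifferentiableAt_extend I E (Y x)) (by simp) (by simp)
  -- For these extensions the bracket on `M` vanishes and the coordinate derivatives cancel by
  -- symmetry. What is left is the torsion of `D` on two commuting extensions in `M'`.
  have h2 : Φ (FiberBundle.extend E (X x)) (FiberBundle.extend E (Y x)) = 0 := by
    simp only [Φ, mlieBracket_extend, map_zero, sub_zero, covDerivAlong_apply,
      FiberBundle.extend_apply_self]
    rw [mvfderiv_alongCoord_extend_comm hi (X x) (Y x), add_sub_add_left_eq_sub]
    have h3 := D.torsion_eq_zero_iff.1 hD
      (FiberBundle.mdifferentiableAt_extend I' E' (mfderiv I I' i x (X x)))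
      (FiberBundle.mdifferentiableAt_extend I' E' (mfderiv I I' i x (Y x)))
    rw [mlieBracket_extend] at h3
    simpa using h3
  rw [h2] at h1
  exact sub_eq_zero.1 h1

end Pushforward

/-! ### Gauss and Weingarten formulas and the derivatives of `P` and `u_α` -/

section InducedStructure

variable {E : Type*} [NormedAddCommGroup E] [NormedSpace ℝ E] [FiniteDimensional ℝ E]
  {H : Type*} [TopologicalSpace H] {I : ModelWithCorners ℝ E H}
  {M : Type*} [TopologicalSpace M] [ChartedSpace H M] [IsManifold I ∞ M]
  [RiemannianBundle (fun x : M ↦ TangentSpace I x)]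
  {E' : Type*} [NormedAddCommGroup E'] [NormedSpace ℝ E'] [FiniteDimensional ℝ E']
  {H' : Type*} [TopologicalSpace H'] {I' : ModelWithCorners ℝ E' H'}
  {M' : Type*} [TopologicalSpace M'] [ChartedSpace H' M'] [IsManifold I' ∞ M']
  [RiemannianBundle (fun y : M' ↦ TangentSpace I' y)]
  {i : M → M'} {x : M}

theorem inner_tangentialPart (Z : TangentSpace I' (i x)) (v : TangentSpace I x) :
    (inner ℝ (tangentialPart I I' i x Z) v : ℝ) = inner ℝ Z (mfderiv I I' i x v) := by
  have : FiniteDimensional ℝ (TangentSpace I x) := inferInstanceAs (FiniteDimensional ℝ E)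
  have : FiniteDimensional ℝ (TangentSpace I' (i x)) :=
    inferInstanceAs (FiniteDimensional ℝ E')
  have : CompleteSpace (TangentSpace I x) := FiniteDimensional.complete ℝ _
  have : CompleteSpace (TangentSpace I' (i x)) := FiniteDimensional.complete ℝ _
  exact ContinuousLinearMap.adjoint_inner_left _ _ _

theorem IsIsometricImmersion.tangentialPart_mfderiv (hi : IsIsometricImmersion I I' i)
    (v : TangentSpace I x) : tangentialPart I I' i x (mfderiv I I' i x v) = v :=
  ext_inner_right ℝ fun w ↦ by rw [inner_tangentialPart, hi.isometric]

theorem IsIsometricImmersion.injective (hi : IsIsometricImmersion I I' i) (x : M) :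
    Function.Injective (mfderiv I I' i x) :=
  Function.LeftInverse.injective fun v ↦ hi.tangentialPart_mfderiv v

/-- The tangential part of `D_X(i_* Y)` plays the role of the connection of `M`; this is its
torsion-freeness, used to expand every bracket in the Nijenhuis torsion. -/
theorem IsIsometricImmersion.tangentialPart_mlieBracket [I.Boundaryless]
    {D : CovariantDerivative I' E' (fun y : M' ↦ TangentSpace I' y)} (hD : D.torsion = 0)
    (hi : IsIsometricImmersion I I' i) {X Y : Π x : M, TangentSpace I x}
    (hX : MDifferentiableAt I I.tangent (fun y ↦ (⟨y, X y⟩ : TangentBundle I M)) x)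
    (hY : MDifferentiableAt I I.tangent (fun y ↦ (⟨y, Y y⟩ : TangentBundle I M)) x) :
    VectorField.mlieBracket I X Y x =
      tangentialPart I I' i x (covDerivAlong I D i (fun y ↦ mfderiv I I' i y (Y y)) x (X x))
      - tangentialPart I I' i x
        (covDerivAlong I D i (fun y ↦ mfderiv I I' i y (X y)) x (Y x)) := by
  rw [← map_sub, covDerivAlong_mfderiv_sub D hD hi.smooth hX hY, hi.tangentialPart_mfderiv]

theorem MDiffAlongAt.sum {ι : Type*} (s : Finset ι) {V : ι → Π x : M, TangentSpace I' (i x)}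
    (hi : MDifferentiableAt I I' i x) (hV : ∀ k, MDiffAlongAt I I' (V k) x) :
    MDiffAlongAt I I' (fun y ↦ ∑ k ∈ s, V k y) x := by
  classical
  induction s using Finset.induction_on with
  | empty =>
    simp only [Finset.sum_empty]
    exact .comp (s := fun y ↦ (0 : TangentSpace I' y))
      (mdifferentiableAt_zeroSection (𝕜 := ℝ) (E := fun y : M' ↦ TangentSpace I' y)) hi
  | insert k s hk ih =>
    simp only [Finset.sum_insert hk]
    exact (hV k).add ih

theorem covDerivAlong_sum (D : CovariantDerivative I' E' (fun y : M' ↦ TangentSpace I' y))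
    {ι : Type*} (s : Finset ι) {V : ι → Π x : M, TangentSpace I' (i x)}
    (hi : MDifferentiableAt I I' i x) (hV : ∀ k, MDiffAlongAt I I' (V k) x)
    (v : TangentSpace I x) :
    covDerivAlong I D i (fun y ↦ ∑ k ∈ s, V k y) x v = ∑ k ∈ s, covDerivAlong I D i (V k) x v := by
  classical
  induction s using Finset.induction_on with
  | empty =>
    simp only [Finset.sum_empty]
    rw [covDerivAlong_comp (s := fun y ↦ (0 : TangentSpace I' y)) D
      (mdifferentiableAt_zeroSection (𝕜 := ℝ) (E := fun y : M' ↦ TangentSpace I' y)) hi]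
    exact DFunLike.congr_fun (congrFun (CovariantDerivative.zero D) (i x)) _
  | insert k s hk ih =>
    simp only [Finset.sum_insert hk]
    rw [covDerivAlong_add D (hV k) (.sum s hi hV), ih]

variable {U : Set M} {r : ℕ} {N : Fin r → Π x : M, TangentSpace I' (i x)}

theorem IsOrthonormalNormalFrame.mdiffAlongAt (hN : IsOrthonormalNormalFrame I I' i U N)
    (hU : IsOpen U) (hx : x ∈ U) (α : Fin r) : MDiffAlongAt I I' (N α) x :=
  ((hN.smooth α).contMDiffAt (hU.mem_nhds hx)).mdifferentiableAt (by simp)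

theorem IsOrthonormalNormalFrame.tangentialPart_eq_zero
    (hN : IsOrthonormalNormalFrame I I' i U N) (hx : x ∈ U) (α : Fin r) :
    tangentialPart I I' i x (N α x) = 0 :=
  ext_inner_right ℝ fun w ↦ by
    rw [inner_tangentialPart, real_inner_comm, hN.normal x hx, inner_zero_left]

/-- The Gauss decomposition of a tangent vector of `M'` into a tangential and a normal part. -/
theorem IsOrthonormalNormalFrame.decomposition (hN : IsOrthonormalNormalFrame I I' i U N)
    (hi : IsIsometricImmersion I I' i)
    (hr : Module.finrank ℝ E' = Module.finrank ℝ E + r) (hx : x ∈ U)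
    (Z : TangentSpace I' (i x)) :
    Z = mfderiv I I' i x (tangentialPart I I' i x Z)
      + ∑ α, (inner ℝ (N α x) Z : ℝ) • N α x := by
  have : FiniteDimensional ℝ (TangentSpace I x) := inferInstanceAs (FiniteDimensional ℝ E)
  have : FiniteDimensional ℝ (TangentSpace I' (i x)) :=
    inferInstanceAs (FiniteDimensional ℝ E')
  -- Tangential parts and inner products with the `N_α` recover `(v, c)` from its image, so `T` is
  -- injective; the codimension hypothesis makes it surjective.
  let T : TangentSpace I x × (Fin r → ℝ) →ₗ[ℝ] TangentSpace I' (i x) :=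
    LinearMap.coprod (mfderiv I I' i x : TangentSpace I x →ₗ[ℝ] TangentSpace I' (i x))
      (Fintype.linearCombination ℝ (fun α ↦ N α x))
  have hT (v : TangentSpace I x) (c : Fin r → ℝ) :
      T (v, c) = mfderiv I I' i x v + ∑ α, c α • N α x := rfl
  have htp (v : TangentSpace I x) (c : Fin r → ℝ) : tangentialPart I I' i x (T (v, c)) = v := by
    rw [hT, map_add, hi.tangentialPart_mfderiv, map_sum]
    simp [hN.tangentialPart_eq_zero hx]
  have hnor (v : TangentSpace I x) (c : Fin r → ℝ) (β : Fin r) :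
      (inner ℝ (N β x) (T (v, c)) : ℝ) = c β := by
    rw [hT, inner_add_right, real_inner_comm, hN.normal x hx, zero_add,
      (hN.orthonormal x hx).inner_right_fintype]
  have hinj : Function.Injective T := by
    rintro ⟨v, c⟩ ⟨v', c'⟩ h
    refine Prod.ext ?_ (funext fun β ↦ ?_)
    · rw [← htp v c, h, htp]
    · exact (hnor v c β).symm.trans ((congrArg _ h).trans (hnor v' c' β))
  have hfin : Module.finrank ℝ (TangentSpace I x × (Fin r → ℝ)) =
      Module.finrank ℝ (TangentSpace I' (i x)) := by
    rw [Module.finrank_prod, Module.finrank_fin_fun]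
    exact hr.symm
  obtain ⟨⟨v, c⟩, rfl⟩ :=
    (LinearMap.injective_iff_surjective_of_finrank_eq_finrank hfin).1 hinj Z
  simp only [htp, hnor]
  rfl

variable {p q : ℕ} {D : CovariantDerivative I' E' (fun y : M' ↦ TangentSpace I' y)}
  {J : Π y : M', TangentSpace I' y →L[ℝ] TangentSpace I' y}

theorem inducedForm_apply (ν : Π x : M, TangentSpace I' (i x)) (v : TangentSpace I x) :
    inducedForm I i J ν x v = inner ℝ (ν x) (J (i x) (mfderiv I I' i x v)) := rfl

theorem normalConnectionCoeff_apply (ν η : Π x : M, TangentSpace I' (i x))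
    (v : TangentSpace I x) :
    normalConnectionCoeff I D i ν η x v = inner ℝ (η x) (covDerivAlong I D i ν x v) := rfl

theorem inner_shapeOperator (ν : Π x : M, TangentSpace I' (i x)) (v w : TangentSpace I x) :
    (inner ℝ (shapeOperator I D i ν x v) w : ℝ) =
      - inner ℝ (covDerivAlong I D i ν x v) (mfderiv I I' i x w) := by
  rw [← inner_tangentialPart, ← inner_neg_left]
  rfl

theorem tangentialPart_covDerivAlong (ν : Π x : M, TangentSpace I' (i x))
    (v : TangentSpace I x) :
    tangentialPart I I' i x (covDerivAlong I D i ν x v) = - shapeOperator I D i ν x v :=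
  (neg_neg _).symm

/-- This is where self-adjointness of `J` enters: it makes `u_α` the metric dual of `ξ_α`. -/
theorem IsMetallicRiemannian.inner_inducedField (hJ : IsMetallicRiemannian p q J)
    (ν : Π x : M, TangentSpace I' (i x)) (v : TangentSpace I x) :
    (inner ℝ v (inducedField I i J ν x) : ℝ) = inducedForm I i J ν x v := by
  rw [inducedForm_apply, real_inner_comm, ← hJ.compatible]
  exact inner_tangentialPart _ _

/-- Expresses `i_*(PX)` through fields along `i` whose differentiability and derivatives are already
known. -/
theorem IsOrthonormalNormalFrame.mfderiv_inducedP (hN : IsOrthonormalNormalFrame I I' i U N)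
    (hi : IsIsometricImmersion I I' i)
    (hr : Module.finrank ℝ E' = Module.finrank ℝ E + r) (hx : x ∈ U)
    (v : TangentSpace I x) :
    mfderiv I I' i x (inducedP i J x v) = J (i x) (mfderiv I I' i x v)
      + ∑ α, (- inducedForm I i J (N α) x v) • N α x := by
  have h := hN.decomposition hi hr hx (J (i x) (mfderiv I I' i x v))
  conv_rhs => rw [h]
  simp only [neg_smul, Finset.sum_neg_distrib, inducedForm_apply, add_neg_cancel_right]
  rfl

variable [IsContMDiffRiemannianBundle I' ∞ E' (fun y : M' ↦ TangentSpace I' y)]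
  {X Y : Π x : M, TangentSpace I x}

theorem IsLocallyMetallic.mdifferentiableAt_inducedForm (hJ : IsLocallyMetallic p q D J)
    (hi : IsIsometricImmersion I I' i) {ν : Π x : M, TangentSpace I' (i x)}
    (hν : MDiffAlongAt I I' ν x)
    (hY : MDifferentiableAt I I.tangent (fun y ↦ (⟨y, Y y⟩ : TangentBundle I M)) x) :
    MDifferentiableAt I 𝓘(ℝ, ℝ) (fun y ↦ inducedForm I i J ν y (Y y)) x :=
  hν.inner ((mdiffAlongAt_mfderiv hi.smooth hY).clm hJ.smooth)

theorem IsLocallyMetallic.mdiffAlongAt_inducedP (hJ : IsLocallyMetallic p q D J)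
    (hi : IsIsometricImmersion I I' i) (hN : IsOrthonormalNormalFrame I I' i U N)
    (hr : Module.finrank ℝ E' = Module.finrank ℝ E + r) (hU : IsOpen U) (hx : x ∈ U)
    (hY : MDifferentiableAt I I.tangent (fun y ↦ (⟨y, Y y⟩ : TangentBundle I M)) x) :
    MDiffAlongAt I I' (fun y ↦ mfderiv I I' i y (inducedP i J y (Y y))) x := by
  have h (α : Fin r) := (hJ.mdifferentiableAt_inducedForm hi (hN.mdiffAlongAt hU hx α) hY).neg
  have hJY := (mdiffAlongAt_mfderiv hi.smooth hY).clm hJ.smooth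
  refine (hJY.add (.sum Finset.univ hJY.base fun α ↦
    (hN.mdiffAlongAt hU hx α).smul (h α))).congr ?_
  filter_upwards [hU.mem_nhds hx] with y hy
  exact hN.mfderiv_inducedP hi hr hy _

theorem IsLocallyMetallic.mdifferentiableAt_inducedP (hJ : IsLocallyMetallic p q D J)
    (hi : IsIsometricImmersion I I' i) (hN : IsOrthonormalNormalFrame I I' i U N)
    (hr : Module.finrank ℝ E' = Module.finrank ℝ E + r) (hU : IsOpen U) (hx : x ∈ U)
    (hY : MDifferentiableAt I I.tangent (fun y ↦ (⟨y, Y y⟩ : TangentBundle I M)) x) :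
    MDifferentiableAt I I.tangent
      (fun y ↦ (⟨y, inducedP i J y (Y y)⟩ : TangentBundle I M)) x :=
  (hJ.mdiffAlongAt_inducedP hi hN hr hU hx hY).of_mfderiv hi.smooth (hi.injective x)

/-- The Gauss formula: the normal component of `D_v (i_* Y)` is given by the shape operators. -/
theorem IsLocallyMetallic.inner_covDerivAlong_mfderiv (hJ : IsLocallyMetallic p q D J)
    (hi : IsIsometricImmersion I I' i) (hN : IsOrthonormalNormalFrame I I' i U N)
    (hU : IsOpen U) (hx : x ∈ U)
    (hY : MDifferentiableAt I I.tangent (fun y ↦ (⟨y, Y y⟩ : TangentBundle I M)) x)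
    (v : TangentSpace I x) (α : Fin r) :
    (inner ℝ (N α x) (covDerivAlong I D i (fun y ↦ mfderiv I I' i y (Y y)) x v) : ℝ) =
      inner ℝ (shapeOperator I D i (N α) x v) (Y x) := by
  have h := mvfderiv_inner_along D hJ.leviCivita (hN.mdiffAlongAt hU hx α)
    (mdiffAlongAt_mfderiv hi.smooth hY) v
  -- Normality holds on the open set `U`, so this inner product vanishes near `x` and its derivative
  -- is zero.
  have h0 : (fun y ↦ (inner ℝ (N α y) (mfderiv I I' i y (Y y)) : ℝ)) =ᶠ[𝓝 x] fun _ ↦ 0 := by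
    filter_upwards [hU.mem_nhds hx] with y hy
    rw [real_inner_comm, hN.normal y hy]
  rw [mvfderiv_congr h0, mvfderiv_const] at h
  rw [inner_shapeOperator]
  simp only [zero_apply] at h
  linarith

/-- By the Gauss formula the difference of the two sides is the inner product of `N_α` with `i_*` of
a bracket, which is tangential. -/
theorem IsLocallyMetallic.shapeOperator_symm [I.Boundaryless] (hJ : IsLocallyMetallic p q D J)
    (hi : IsIsometricImmersion I I' i) (hN : IsOrthonormalNormalFrame I I' i U N)
    (hU : IsOpen U) (hx : x ∈ U) (α : Fin r) (v w : TangentSpace I x) :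
    (inner ℝ (shapeOperator I D i (N α) x v) w : ℝ) =
      inner ℝ (shapeOperator I D i (N α) x w) v := by
  have hv := FiberBundle.mdifferentiableAt_extend I E v
  have hw := FiberBundle.mdifferentiableAt_extend I E w
  have h1 := hJ.inner_covDerivAlong_mfderiv hi hN hU hx hw v α
  have h2 := hJ.inner_covDerivAlong_mfderiv hi hN hU hx hv w α
  have h3 := covDerivAlong_mfderiv_sub D hJ.leviCivita.torsion_free hi.smooth hv hw
  rw [FiberBundle.extend_apply_self] at h1 h2
  rw [← h1, ← h2, ← sub_eq_zero, ← inner_sub_right]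
  simp only [FiberBundle.extend_apply_self] at h3
  rw [h3, real_inner_comm, hN.normal x hx]

/-- The covariant derivative of `P`. -/
theorem IsLocallyMetallic.tangentialPart_covDerivAlong_inducedP (hJ : IsLocallyMetallic p q D J)
    (hi : IsIsometricImmersion I I' i) (hN : IsOrthonormalNormalFrame I I' i U N)
    (hr : Module.finrank ℝ E' = Module.finrank ℝ E + r) (hU : IsOpen U) (hx : x ∈ U)
    (hY : MDifferentiableAt I I.tangent (fun y ↦ (⟨y, Y y⟩ : TangentBundle I M)) x)
    (v : TangentSpace I x) :
    tangentialPart I I' i x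
        (covDerivAlong I D i (fun y ↦ mfderiv I I' i y (inducedP i J y (Y y))) x v) =
      inducedP i J x (tangentialPart I I' i x
        (covDerivAlong I D i (fun y ↦ mfderiv I I' i y (Y y)) x v))
      + ∑ α, ((inner ℝ (shapeOperator I D i (N α) x v) (Y x) : ℝ) • inducedField I i J (N α) x
        + inducedForm I i J (N α) x (Y x) • shapeOperator I D i (N α) x v) := by
  have hu (α : Fin r) : MDifferentiableAt I 𝓘(ℝ, ℝ)
      (fun y ↦ - inducedForm I i J (N α) y (Y y)) x :=
    (hJ.mdifferentiableAt_inducedForm hi (hN.mdiffAlongAt hU hx α) hY).neg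
  have hY' := mdiffAlongAt_mfderiv hi.smooth hY
  have hJY := hY'.clm hJ.smooth
  have huN (α : Fin r) := (hN.mdiffAlongAt hU hx α).smul (hu α)
  have h1 : ∀ᶠ y in 𝓝 x, mfderiv I I' i y (inducedP i J y (Y y)) =
      J (i y) (mfderiv I I' i y (Y y))
        + ∑ α, (- inducedForm I i J (N α) y (Y y)) • N α y := by
    filter_upwards [hU.mem_nhds hx] with y hy
    exact hN.mfderiv_inducedP hi hr hy _
  rw [covDerivAlong_congr D h1, covDerivAlong_add D hJY (.sum _ hJY.base huN),
    covDerivAlong_sum D _ hJY.base huN, covDerivAlong_clm D hJ hY', map_add, map_sum]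
  -- The derivative of the coefficient multiplies `N_α`, which has no tangential part; the two minus
  -- signs, of `-u_α` and of the Weingarten formula, cancel.
  have h2 (α : Fin r) : tangentialPart I I' i x (covDerivAlong I D i
      (fun y ↦ (- inducedForm I i J (N α) y (Y y)) • N α y) x v) =
      inducedForm I i J (N α) x (Y x) • shapeOperator I D i (N α) x v := by
    rw [covDerivAlong_smul D (hu α) (hN.mdiffAlongAt hU hx α), map_add, map_smul, map_smul,
      hN.tangentialPart_eq_zero hx, tangentialPart_covDerivAlong]
    simp
  -- The normal part of `D_v(i_* Y)` is `∑ g(A_α v, Y) N_α`, and the tangential part of `J N_α` is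
  -- `ξ_α`: this produces the `ξ_α` terms.
  have h3 := hN.decomposition hi hr hx
    (covDerivAlong I D i (fun y ↦ mfderiv I I' i y (Y y)) x v)
  simp only [hJ.inner_covDerivAlong_mfderiv hi hN hU hx hY v] at h3
  conv_lhs => rw [h3]
  simp only [h2, map_add, map_sum, map_smul, Finset.sum_add_distrib, add_assoc]
  rfl

/-- Product rule for `g'(N_α, J i_* Y)`, with `D_v N_α` paired against the tangential and normal
parts of `J i_* Y`. The last term is left unexpanded because it cancels in `du_α`. -/
theorem IsLocallyMetallic.mvfderiv_inducedForm (hJ : IsLocallyMetallic p q D J)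
    (hi : IsIsometricImmersion I I' i) (hN : IsOrthonormalNormalFrame I I' i U N)
    (hr : Module.finrank ℝ E' = Module.finrank ℝ E + r) (hU : IsOpen U) (hx : x ∈ U)
    (hY : MDifferentiableAt I I.tangent (fun y ↦ (⟨y, Y y⟩ : TangentBundle I M)) x)
    (v : TangentSpace I x) (α : Fin r) :
    mvfderiv I (fun y ↦ inducedForm I i J (N α) y (Y y)) x v =
      - inner ℝ (shapeOperator I D i (N α) x v) (inducedP i J x (Y x))
      + ∑ β, normalConnectionCoeff I D i (N α) (N β) x v * inducedForm I i J (N β) x (Y x)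
      + inner ℝ (N α x)
        (J (i x) (covDerivAlong I D i (fun y ↦ mfderiv I I' i y (Y y)) x v)) := by
  have hY' := mdiffAlongAt_mfderiv hi.smooth hY
  have h1 := mvfderiv_inner_along D hJ.leviCivita (hN.mdiffAlongAt hU hx α)
    (hY'.clm hJ.smooth) v
  rw [covDerivAlong_clm D hJ hY'] at h1
  refine h1.trans ?_
  congr 1
  have h2 := hN.decomposition hi hr hx (J (i x) (mfderiv I I' i x (Y x)))
  conv_lhs => rw [h2]
  rw [inner_add_right, inner_sum, inner_shapeOperator, neg_neg]
  congr 1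
  refine Finset.sum_congr rfl fun β _ ↦ ?_
  rw [real_inner_smul_right, normalConnectionCoeff_apply, inducedForm_apply,
    real_inner_comm (N β x) (covDerivAlong I D i (N α) x v)]
  ring

/-- The exterior derivative of `u_α`. -/
theorem IsLocallyMetallic.two_mul_exteriorDeriv_inducedForm [I.Boundaryless]
    (hJ : IsLocallyMetallic p q D J)
    (hi : IsIsometricImmersion I I' i) (hN : IsOrthonormalNormalFrame I I' i U N)
    (hr : Module.finrank ℝ E' = Module.finrank ℝ E + r) (hU : IsOpen U) (hx : x ∈ U)
    (hX : MDifferentiableAt I I.tangent (fun y ↦ (⟨y, X y⟩ : TangentBundle I M)) x)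
    (hY : MDifferentiableAt I I.tangent (fun y ↦ (⟨y, Y y⟩ : TangentBundle I M)) x)
    (α : Fin r) :
    2 * exteriorDeriv (inducedForm I i J (N α)) X Y x =
      inner ℝ (shapeOperator I D i (N α) x (Y x)) (inducedP i J x (X x))
      - inner ℝ (shapeOperator I D i (N α) x (X x)) (inducedP i J x (Y x))
      + ∑ β, (normalConnectionCoeff I D i (N α) (N β) x (X x) * inducedForm I i J (N β) x (Y x)
        - normalConnectionCoeff I D i (N α) (N β) x (Y x)
          * inducedForm I i J (N β) x (X x)) := by
  have h := covDerivAlong_mfderiv_sub D hJ.leviCivita.torsion_free hi.smooth hX hY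
  -- By the torsion identity, antisymmetrizing the unexpanded terms gives exactly `u_α([X, Y])`.
  rw [exteriorDeriv, hJ.mvfderiv_inducedForm hi hN hr hU hx hY,
    hJ.mvfderiv_inducedForm hi hN hr hU hx hX, inducedForm_apply (N α), ← h, map_sub,
    inner_sub_right, Finset.sum_sub_distrib]
  ring

/-- The Nijenhuis torsion of `P`. -/
theorem IsLocallyMetallic.nijenhuis_inducedP [I.Boundaryless] (hJ : IsLocallyMetallic p q D J)
    (hi : IsIsometricImmersion I I' i) (hN : IsOrthonormalNormalFrame I I' i U N)
    (hr : Module.finrank ℝ E' = Module.finrank ℝ E + r) (hU : IsOpen U) (hx : x ∈ U)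
    (hX : MDifferentiableAt I I.tangent (fun y ↦ (⟨y, X y⟩ : TangentBundle I M)) x)
    (hY : MDifferentiableAt I I.tangent (fun y ↦ (⟨y, Y y⟩ : TangentBundle I M)) x) :
    nijenhuis (inducedP i J) X Y x =
      ∑ α, (inducedForm I i J (N α) x (X x) • commutatorB I D i J (N α) x (Y x)
        - inducedForm I i J (N α) x (Y x) • commutatorB I D i J (N α) x (X x)
        + ((inner ℝ (shapeOperator I D i (N α) x (Y x)) (inducedP i J x (X x)) : ℝ)
          - inner ℝ (shapeOperator I D i (N α) x (X x)) (inducedP i J x (Y x))) •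
            inducedField I i J (N α) x) := by
  have hPX := hJ.mdifferentiableAt_inducedP hi hN hr hU hx hX
  have hPY := hJ.mdifferentiableAt_inducedP hi hN hr hU hx hY
  have hT := hJ.leviCivita.torsion_free
  have hP {Z : Π x : M, TangentSpace I x}
      (hZ : MDifferentiableAt I I.tangent (fun y ↦ (⟨y, Z y⟩ : TangentBundle I M)) x)
      (v : TangentSpace I x) :=
    hJ.tangentialPart_covDerivAlong_inducedP hi hN hr hU hx hZ v
  have hsymm (α : Fin r) := hJ.shapeOperator_symm hi hN hU hx α
  -- Expanding the four brackets and then `∇(PX)`, `∇(PY)` cancels all derivatives of `X` and `Y`,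
  -- leaving only terms of `∇P`.
  rw [nijenhuis, hi.tangentialPart_mlieBracket hT hPX hPY, hi.tangentialPart_mlieBracket hT hX hY,
    hi.tangentialPart_mlieBracket hT hPX hY, hi.tangentialPart_mlieBracket hT hX hPY,
    hP hX, hP hX, hP hY, hP hY]
  have hB (α : Fin r) (v : TangentSpace I x) : commutatorB I D i J (N α) x v =
    inducedP i J x (shapeOperator I D i (N α) x v) -
      shapeOperator I D i (N α) x (inducedP i J x v) := rfl
  simp only [map_add, map_sub, map_sum, map_smul, hB, Finset.sum_add_distrib,
    Finset.sum_sub_distrib, smul_sub, sub_smul]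
  -- Symmetry of `A_α` turns `g(A_α PX, Y)` into `g(A_α Y, PX)`, and cancels the `Pξ_α` terms, whose
  -- coefficients are `g(A_α Y, X) - g(A_α X, Y)`.
  simp only [hsymm _ (inducedP i J x (X x)), hsymm _ (inducedP i J x (Y x)), hsymm _ (Y x) (X x)]
  simp only [real_inner_comm]
  abel

end InducedStructure

end SigmaMetallic

end

/-! ### The structure equation for `P` -/

theorem mainTheorem4 {n r p q : ℕ}
    {M : Type*} [TopologicalSpace M] [ChartedSpace (EuclideanSpace ℝ (Fin n)) M]
    [IsManifold (𝓡 n) ∞ M]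
    [RiemannianBundle (fun x : M ↦ TangentSpace (𝓡 n) x)]
    [IsContMDiffRiemannianBundle (𝓡 n) ∞ (EuclideanSpace ℝ (Fin n))
      (fun x : M ↦ TangentSpace (𝓡 n) x)]
    {M' : Type*} [TopologicalSpace M'] [ChartedSpace (EuclideanSpace ℝ (Fin (n + r))) M']
    [IsManifold (𝓡 (n + r)) ∞ M']
    [RiemannianBundle (fun y : M' ↦ TangentSpace (𝓡 (n + r)) y)]
    [IsContMDiffRiemannianBundle (𝓡 (n + r)) ∞ (EuclideanSpace ℝ (Fin (n + r)))
      (fun y : M' ↦ TangentSpace (𝓡 (n + r)) y)]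
    (D : CovariantDerivative (𝓡 (n + r)) (EuclideanSpace ℝ (Fin (n + r)))
      (fun y : M' ↦ TangentSpace (𝓡 (n + r)) y))
    (J : Π y : M', TangentSpace (𝓡 (n + r)) y →L[ℝ] TangentSpace (𝓡 (n + r)) y)
    (hJ : IsLocallyMetallic p q D J)
    (i : M → M') (hi : IsIsometricImmersion (𝓡 n) (𝓡 (n + r)) i)
    (U : Set M) (hU : IsOpen U)
    (N : Fin r → Π x : M, TangentSpace (𝓡 (n + r)) (i x))
    (hN : IsOrthonormalNormalFrame (𝓡 n) (𝓡 (n + r)) i U N)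
    (X Y : Π x : M, TangentSpace (𝓡 n) x)
    (hX : ContMDiffOn (𝓡 n) (𝓡 n).tangent ∞ (fun x ↦ (⟨x, X x⟩ : TangentBundle (𝓡 n) M)) U)
    (hY : ContMDiffOn (𝓡 n) (𝓡 n).tangent ∞ (fun x ↦ (⟨x, Y x⟩ : TangentBundle (𝓡 n) M)) U)
    (x : M) (hx : x ∈ U) :
    nijenhuis (inducedP i J) X Y x
        - (2 : ℝ) • ∑ α, exteriorDeriv (inducedForm (𝓡 n) i J (N α)) X Y x •
            inducedField (𝓡 n) i J (N α) x
      = ∑ α, ((inner ℝ (X x) (inducedField (𝓡 n) i J (N α) x) : ℝ) •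
              commutatorB (𝓡 n) D i J (N α) x (Y x)
            - (inner ℝ (Y x) (inducedField (𝓡 n) i J (N α) x) : ℝ) •
              commutatorB (𝓡 n) D i J (N α) x (X x))
        - ∑ α, ∑ β,
            (normalConnectionCoeff (𝓡 n) D i (N α) (N β) x (X x) *
                inner ℝ (Y x) (inducedField (𝓡 n) i J (N β) x)
              - normalConnectionCoeff (𝓡 n) D i (N α) (N β) x (Y x) *
                inner ℝ (X x) (inducedField (𝓡 n) i J (N β) x)) •
            inducedField (𝓡 n) i J (N α) x := by
  have hr : Module.finrank ℝ (EuclideanSpace ℝ (Fin (n + r))) =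
      Module.finrank ℝ (EuclideanSpace ℝ (Fin n)) + r := by simp
  have hX' := (hX.contMDiffAt (hU.mem_nhds hx)).mdifferentiableAt (by simp)
  have hY' := (hY.contMDiffAt (hU.mem_nhds hx)).mdifferentiableAt (by simp)
  rw [hJ.nijenhuis_inducedP hi hN hr hU hx hX' hY', Finset.smul_sum]
  -- The factor 2 is absorbed by the normalisation of `du_α`, and each `g(·, ξ_α)` becomes `u_α`;
  -- the identity then holds separately for each `α`.
  simp only [hJ.inner_inducedField, smul_smul,
    hJ.two_mul_exteriorDeriv_inducedForm hi hN hr hU hx hX' hY', ← Finset.sum_smul]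
  rw [← Finset.sum_sub_distrib, ← Finset.sum_sub_distrib]
  refine Finset.sum_congr rfl fun α _ ↦ ?_
  module
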